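/- Let $d\ge 0$ be an integer. A Lévy measure on $\mathbb R^d$ is a Borel measure $M$ with $M(\{0\})=0$ and $\int(|x|^2\wedge 1)\,M(\mathrm dx)<\infty$. For a $\sigma$-finite Borel measure $\rho$ on $(0,\infty)$ and a Lévy measure $M$ put $[\Upsilon_\rho M](B)=\int_0^\infty M(s^{-1}B)\,\rho(\mathrm ds)$ for Borel sets $B\subseteq\mathbb R^d$, and let $\mathfrak D(\Upsilon_\rho)$ be the set of all Lévy measures $M$ for which $\Upsilon_\rho M$ is again a Lévy measure. Let $\Psi_{\alpha,p}$ ($\alpha\in\mathbb R$, $p>0$), $\mathfrak T_{\beta\to\alpha,p}$ ($\beta<\alpha$, $p>0$) and $\mathfrak P_{\alpha,p\to q}$ ($\alpha\in\mathbb R$, $0<q<p$) be the transforms $\Upsilon_\rho$ whose measures $\rho(\mathrm ds)$ are, respectively, $$s^{-\alpha-1}e^{-s^p}1_{s>0}\,\mathrm ds,\qquad \frac{1}{K_{\alpha,\beta,p}}s^{-\alpha-1}(1-s^p)^{(\alpha-\beta)/p-1}1_{0<s<1}\,\mathrm ds,\qquad p f_{q/p}(s^{-p})s^{-\alpha-p-1}1_{s>0}\,\mathrm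 ds,$$ where $K_{\alpha,\beta,p}=\int_0^\infty u^{\alpha-\beta-1}e^{-u^p}\,\mathrm du$ and, for $r\in(0,1)$, $f_r$ is the probability density on $(0,\infty)$ with Laplace transform $\int_0^\infty e^{-tx}f_r(x)\,\mathrm dx=e^{-t^r}$, $t\ge0$. For $\alpha<2$ and $p>0$, a $p$-tempered $\alpha$-stable law is an infinitely divisible probability law on $\mathbb R^d$ without Gaussian part whose Lévy measure is $\Psi_{\alpha,p}M$ for some $M\in\mathfrak D(\Psi_{\alpha,p})$; let $LTS^p_\alpha$ be the class of the Lévy measures of these laws. (1) If $\beta<\alpha<2$ and $p>0$, then $\mathfrak T_{\beta\to\alpha,p}$, restricted to $LTS^p_\beta\cap\mathfrak D(\mathfrak T_{\beta\to\alpha,p})$, is a bijection from this set onto $LTS^p_\alpha$. (2) If $0<q<p$ and $\alpha<2$, then $LTS^p_\alpha\subseteq\mathfrak D(\mathfrak P_{\alpha,p\to q})$, and $\mathfrak P_{\alpha,p\to q}$, restricted to $LTS^p_\alpha$, is a bijection from $LTS^p_\alpha$ onto $LTS^q_\alpha$. -/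

import Mathlib

open MeasureTheory Set

namespace TemperedStable

/-- A Lévy measure on `ℝ^d`: a Borel measure without mass at the origin that integrates
`|x|^2 ∧ 1`. -/
def IsLevyMeasure {d : ℕ} (M : Measure (EuclideanSpace ℝ (Fin d))) : Prop :=
  M {0} = 0 ∧ ∫⁻ x, ENNReal.ofReal (min (‖x‖ ^ 2) 1) ∂M < ⊤

/-- The upsilon transform with dilation measure `ρ`, a measure on `ℝ` that is carried by `(0, ∞)`:
the image of `ρ ⊗ M` under `(s, x) ↦ s • x`. See `upsilon_apply` for the formula
`B ↦ ∫ M (s⁻¹ B) ρ(ds)`. -/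
noncomputable def upsilon {d : ℕ} (ρ : Measure ℝ) (M : Measure (EuclideanSpace ℝ (Fin d))) :
    Measure (EuclideanSpace ℝ (Fin d)) :=
  (ρ.prod M).map (fun z : ℝ × EuclideanSpace ℝ (Fin d) => z.1 • z.2)

/-- The domain of the upsilon transform: the Lévy measures with a Lévy measure as image. -/
def upsilonDomain (d : ℕ) (ρ : Measure ℝ) : Set (Measure (EuclideanSpace ℝ (Fin d))) :=
  {M | IsLevyMeasure M ∧ IsLevyMeasure (upsilon ρ M)}

/-- The range of the upsilon transform. -/
def upsilonRange (d : ℕ) (ρ : Measure ℝ) : Set (Measure (EuclideanSpace ℝ (Fin d))) :=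
  {M | ∃ M' ∈ upsilonDomain d ρ, M = upsilon ρ M'}

/-- The measure `s^(-α-1) exp(-s^p) ds` on `(0, ∞)`. -/
noncomputable def psi (α p : ℝ) : Measure ℝ :=
  (volume.restrict (Ioi (0 : ℝ))).withDensity
    (fun s => ENNReal.ofReal (s ^ (-α - 1) * Real.exp (-(s ^ p))))

/-- The constant `∫_0^∞ u^(α-β-1) exp(-u^p) du`. -/
noncomputable def tauConst (β α p : ℝ) : ℝ :=
  ∫ u in Ioi (0 : ℝ), u ^ (α - β - 1) * Real.exp (-(u ^ p))

/-- The measure `K⁻¹ s^(-α-1) (1 - s^p)^((α-β)/p-1) ds` on `(0, 1)`. -/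
noncomputable def tau (β α p : ℝ) : Measure ℝ :=
  (volume.restrict (Ioo (0 : ℝ) 1)).withDensity
    (fun s => ENNReal.ofReal
      (1 / tauConst β α p * s ^ (-α - 1) * (1 - s ^ p) ^ ((α - β) / p - 1)))

/-- `f`, restricted to `(0, ∞)`, is a density of the fully right skewed `r`-stable law with Laplace
transform `exp(-t^r)`. (The case `t = 0` says that the total mass is one.) -/
def IsStableDensity (r : ℝ) (f : ℝ → ℝ) : Prop :=
  Measurable f ∧ (∀ x, 0 < x → 0 ≤ f x) ∧
    ∀ t : ℝ, 0 ≤ t → ∫ x in Ioi (0 : ℝ), Real.exp (-(t * x)) * f x = Real.exp (-(t ^ r))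

/-- The density `f_r` of the fully right skewed `r`-stable law, `0 < r < 1`. It is determined
almost everywhere on `(0, ∞)` by its Laplace transform. -/
noncomputable def stableDensity (r : ℝ) : ℝ → ℝ :=
  Classical.epsilon (IsStableDensity r)

/-- The measure `p f_{q/p}(s^(-p)) s^(-α-p-1) ds` on `(0, ∞)`. -/
noncomputable def piMeasure (α p q : ℝ) : Measure ℝ :=
  (volume.restrict (Ioi (0 : ℝ))).withDensity
    (fun s => ENNReal.ofReal (p * stableDensity (q / p) (s ^ (-p)) * s ^ (-α - p - 1)))

/-- `μ` is the infinitely divisible law with Gaussian covariance matrix `A`, Lévy measure `ν` and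
shift `γ`, in the Lévy-Khintchine representation with the truncation `1_{|x| ≤ 1}`. -/
structure HasLevyTriplet {d : ℕ} (μ : Measure (EuclideanSpace ℝ (Fin d)))
    (A : Matrix (Fin d) (Fin d) ℝ) (ν : Measure (EuclideanSpace ℝ (Fin d)))
    (γ : EuclideanSpace ℝ (Fin d)) : Prop where
  isProbabilityMeasure : IsProbabilityMeasure μ
  posSemidef : A.PosSemidef
  isLevyMeasure : IsLevyMeasure ν
  charFun_eq : ∀ z : EuclideanSpace ℝ (Fin d),
    charFun μ z = Complex.exp
      (-(1 / 2) * ((z.ofLp ⬝ᵥ A.mulVec z.ofLp : ℝ) : ℂ)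
        + Complex.I * ((inner ℝ γ z : ℝ) : ℂ)
        + ∫ x, (Complex.exp (Complex.I * ((inner ℝ x z : ℝ) : ℂ)) - 1
            - Complex.I * (((if ‖x‖ ≤ 1 then inner ℝ x z else 0 : ℝ)) : ℂ)) ∂ν)

/-- `μ` is a `p`-tempered `α`-stable law on `ℝ^d` and `ν` is its Lévy measure: `μ` is infinitely
divisible without Gaussian part, and its Lévy measure `ν` is the image under `Ψ_{α,p}` of a measure
in the domain of `Ψ_{α,p}`. -/
def IsTemperedStable {d : ℕ} (α p : ℝ) (μ ν : Measure (EuclideanSpace ℝ (Fin d))) : Prop :=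
  (∃ γ, HasLevyTriplet μ 0 ν γ) ∧ ν ∈ upsilonRange d (psi α p)

/-- The class of the Lévy measures of `p`-tempered `α`-stable laws on `ℝ^d`. -/
def LTS (d : ℕ) (α p : ℝ) : Set (Measure (EuclideanSpace ℝ (Fin d))) :=
  {ν | ∃ μ, IsTemperedStable α p μ ν}

theorem upsilon_apply {d : ℕ} (ρ : Measure ℝ) (M : Measure (EuclideanSpace ℝ (Fin d))) [SFinite M]
    {B : Set (EuclideanSpace ℝ (Fin d))} (hB : MeasurableSet B) :
    upsilon ρ M B = ∫⁻ s, M ((fun x => s • x) ⁻¹' B) ∂ρ := by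
  have hm : Measurable (fun z : ℝ × EuclideanSpace ℝ (Fin d) => z.1 • z.2) := by fun_prop
  rw [upsilon, Measure.map_apply hm hB, Measure.prod_apply (hm hB)]
  rfl

/-- Lévy measures are σ-finite, so that `upsilon_apply` covers them. -/
theorem IsLevyMeasure.sigmaFinite {d : ℕ} {M : Measure (EuclideanSpace ℝ (Fin d))}
    (h : IsLevyMeasure M) : SigmaFinite M := by
  have hf : Measurable (fun x : EuclideanSpace ℝ (Fin d) => ENNReal.ofReal (min (‖x‖ ^ 2) 1)) := by
    fun_prop
  refine Measure.FiniteSpanningSetsIn.sigmaFinite (C := univ)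
    (μ := M) ⟨fun n => {0} ∪ {x | ((n : ENNReal) + 1)⁻¹ ≤ ENNReal.ofReal (min (‖x‖ ^ 2) 1)},
      fun _ => trivial, fun n => ?_, ?_⟩
  · refine lt_of_le_of_lt (measure_union_le _ _) ?_
    rw [h.1, zero_add]
    refine lt_of_le_of_lt (meas_ge_le_lintegral_div hf.aemeasurable (by simp) (by simp)) ?_
    exact ENNReal.div_lt_top h.2.ne (by simp)
  · refine eq_univ_of_forall fun x => ?_
    by_cases hx : x = 0
    · exact mem_iUnion.2 ⟨0, Or.inl hx⟩
    · have hpos : ENNReal.ofReal (min (‖x‖ ^ 2) 1) ≠ 0 := by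
        have : 0 < ‖x‖ := norm_pos_iff.2 hx
        simp only [ne_eq, ENNReal.ofReal_eq_zero, not_le]
        positivity
      obtain ⟨n, hn⟩ := ENNReal.exists_inv_nat_lt hpos
      refine mem_iUnion.2 ⟨n, Or.inr (le_trans ?_ hn.le)⟩
      exact ENNReal.inv_le_inv.2 le_self_add

end TemperedStable

namespace TemperedStable
open Filter Topology

/-! Upsilon transforms compose by multiplicative convolution of their dilation measures
(`upsilon_upsilon`). Two such convolutions can be computed: `tau β α p` with `psi β p` gives `psi α
p`, by a Gamma integral (`lintegral_tau_density`), and `piMeasure α p q` with `psi α p` gives `psi α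
q`, because the Laplace transform of the stable density at `t^p` is `exp(-t^q)`
(`lintegral_piMeasure_density`). So, on Lévy measures `M`, the transform in (1) sends `Ψ_{β,p} M` to
`Ψ_{α,p} M` and the one in (2) sends `Ψ_{α,p} M` to `Ψ_{α,q} M`.

Both bijections follow from two facts about `Ψ`. It is injective on its domain
(`injOn_upsilon_psi`), since dilating `Ψ_{α,p} M` produces a Laplace transform in the variable `u^p`
from which `M` is recovered. Its domain shrinks as `α` grows and is the same for all `p`
(`upsilonDomain_psi_mono`). In (1) the intersection with the domain of the transform selects exactly
the `Ψ_{β,p} M` with `M` in the smaller domain for `α`; in (2) the two domains agree.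

Two existence statements are needed besides. A law must exist for each Lévy measure, so that `LTS`
is the whole range of `Ψ` (`LTS_eq_upsilonRange`), and a stable density must exist, because
`stableDensity` is a mere choice (`exists_isStableDensity`). Both laws are weak limits of compound
Poisson laws, by `exists_tendsto_compensatedPoisson`. -/

/-! ### Compound Poisson laws. -/

/-- The convolution powers of a measure. -/
noncomputable def convPow {E : Type*} [AddMonoid E] [MeasurableSpace E] (ν : Measure E) :
    ℕ → Measure E
  | 0 => Measure.dirac 0
  | k + 1 => convPow ν k ∗ ν

instance {E : Type*} [AddMonoid E] [MeasurableSpace E] (ν : Measure E) [IsFiniteMeasure ν] (k : ℕ) :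
    IsFiniteMeasure (convPow ν k) := by
  induction k with
  | zero => exact inferInstanceAs (IsFiniteMeasure (Measure.dirac 0))
  | succ k ih => exact inferInstanceAs (IsFiniteMeasure (convPow ν k ∗ ν))

/-- The compound Poisson law with jump measure `ν`. -/
noncomputable def compoundPoisson {E : Type*} [AddMonoid E] [MeasurableSpace E] (ν : Measure E) :
    Measure E :=
  Measure.sum fun k : ℕ =>
    ENNReal.ofReal (Real.exp (-ν.real univ) / k.factorial) • convPow ν k

section
variable {E : Type*} [AddCommMonoid E] [MeasurableSpace E] [MeasurableAdd₂ E]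
  (ν : Measure E) [IsFiniteMeasure ν]

theorem convPow_univ (k : ℕ) : convPow ν k univ = ν univ ^ k := by
  induction k with
  | zero => simp [convPow]
  | succ k ih =>
    rw [convPow, Measure.conv, Measure.map_apply (by fun_prop) MeasurableSet.univ, preimage_univ,
      Measure.prod_apply MeasurableSet.univ]
    simp [ih, pow_succ, mul_comm]

instance : IsProbabilityMeasure (compoundPoisson ν) := by
  constructor
  rw [compoundPoisson, Measure.sum_apply _ MeasurableSet.univ]
  have h : ∀ k : ℕ, (ENNReal.ofReal (Real.exp (-ν.real univ) / k.factorial) • convPow ν k) univ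
      = ENNReal.ofReal (Real.exp (-ν.real univ) * (ν.real univ ^ k / k.factorial)) := by
    intro k
    rw [Measure.smul_apply, convPow_univ, smul_eq_mul, ← ofReal_measureReal,
      ← ENNReal.ofReal_pow measureReal_nonneg, ← ENNReal.ofReal_mul (by positivity)]
    ring_nf
  have hs := (NormedSpace.expSeries_div_hasSum_exp (ν.real univ)).mul_left
    (Real.exp (-ν.real univ))
  simp_rw [h]
  rw [← ENNReal.ofReal_tsum_of_nonneg (fun k => by positivity) hs.summable, hs.tsum_eq,
    ← Real.exp_eq_exp_ℝ, ← Real.exp_add]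
  simp

end

theorem ae_mem_convPow {E : Type*} [AddCommMonoid E] [MeasurableSpace E] [MeasurableAdd₂ E]
    {ν : Measure E} {S : AddSubmonoid E} (hS : MeasurableSet (S : Set E)) (hν : ∀ᵐ x ∂ν, x ∈ S)
    (k : ℕ) : ∀ᵐ x ∂(convPow ν k), x ∈ S := by
  induction k with
  | zero => exact (ae_dirac_iff hS).2 S.zero_mem
  | succ k ih =>
    rw [convPow, Measure.conv]
    refine (ae_map_iff (by fun_prop) hS).2 ?_
    filter_upwards [Measure.quasiMeasurePreserving_fst.ae ih,
      Measure.quasiMeasurePreserving_snd.ae hν] with z h1 h2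
    exact S.add_mem h1 h2

theorem ae_mem_compoundPoisson {E : Type*} [AddCommMonoid E] [MeasurableSpace E]
    [MeasurableAdd₂ E] {ν : Measure E} {S : AddSubmonoid E} (hS : MeasurableSet (S : Set E))
    (hν : ∀ᵐ x ∂ν, x ∈ S) : ∀ᵐ x ∂(compoundPoisson ν), x ∈ S :=
  Measure.ae_sum_iff.2 fun k => Measure.ae_smul_measure (ae_mem_convPow hS hν k) _

/-- The integral, with respect to a compound Poisson law, of a bounded function that is a character
on a semigroup which carries the jumps. -/
theorem integral_compoundPoisson {E : Type*} [AddCommMonoid E] [MeasurableSpace E]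
    [MeasurableAdd₂ E] {ν : Measure E} [IsFiniteMeasure ν] {S : AddSubmonoid E}
    (hS : MeasurableSet (S : Set E)) (hν : ∀ᵐ x ∂ν, x ∈ S) {F : E → ℂ} (hF : Measurable F)
    (hF1 : ∀ x, ‖F x‖ ≤ 1) (hF0 : F 0 = 1) (hFm : ∀ x ∈ S, ∀ y ∈ S, F (x + y) = F x * F y) :
    ∫ x, F x ∂(compoundPoisson ν) = Complex.exp (∫ x, (F x - 1) ∂ν) := by
  have hint : ∀ (m : Measure E) [IsFiniteMeasure m], Integrable F m := fun m _ =>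
    Integrable.of_bound hF.aestronglyMeasurable 1 (ae_of_all _ hF1)
  have hpow : ∀ k, ∫ x, F x ∂(convPow ν k) = (∫ x, F x ∂ν) ^ k := by
    intro k
    induction k with
    | zero => simp [convPow, integral_dirac' _ _ hF.stronglyMeasurable, hF0]
    | succ k ih =>
      rw [convPow, integral_conv (hint _), pow_succ, ← ih, ← integral_mul_const]
      refine integral_congr_ae ?_
      filter_upwards [ae_mem_convPow hS hν k] with x hx
      rw [← integral_const_mul]
      refine integral_congr_ae ?_
      filter_upwards [hν] with y hy using hFm x hx y hy
  have h1 : HasSum (fun k : ℕ => ∫ x, F x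
      ∂(ENNReal.ofReal (Real.exp (-ν.real univ) / k.factorial) • convPow ν k))
      (∫ x, F x ∂(compoundPoisson ν)) :=
    hasSum_integral_measure (hint (compoundPoisson ν))
  have h2 := (NormedSpace.expSeries_div_hasSum_exp (∫ x, F x ∂ν)).mul_left
    (Complex.exp (-(ν.real univ : ℂ)))
  refine (h1.unique (h2.congr_fun fun k => ?_)).trans ?_
  · rw [integral_smul_measure, hpow, ENNReal.toReal_ofReal (by positivity), Complex.real_smul]
    push_cast
    ring
  · rw [integral_sub (hint ν) (integrable_const _), integral_const,
      ← Complex.exp_eq_exp_ℂ, ← Complex.exp_add]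
    simp [sub_eq_neg_add]

theorem charFun_compoundPoisson {E : Type*} [NormedAddCommGroup E] [InnerProductSpace ℝ E]
    [MeasurableSpace E] [BorelSpace E] [SecondCountableTopology E] (ν : Measure E)
    [IsFiniteMeasure ν] (z : E) :
    charFun (compoundPoisson ν) z
      = Complex.exp (∫ x, (Complex.exp (Complex.I * ((inner ℝ x z : ℝ) : ℂ)) - 1) ∂ν) := by
  rw [charFun_apply]
  simp_rw [mul_comm _ Complex.I]
  refine integral_compoundPoisson (S := ⊤) (by simp) (by simp) (by fun_prop) (fun x => ?_) (by simp)
    (fun x _ y _ => ?_)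
  · rw [mul_comm, Complex.norm_exp_ofReal_mul_I]
  · rw [← Complex.exp_add, inner_add_left]
    push_cast
    ring_nf

/-- A compound Poisson law with absolutely continuous jumps has no singular part except for the
atom at `0`. -/
theorem compoundPoisson_null_le {ν : Measure ℝ} [IsFiniteMeasure ν] (hν : ν ≪ volume) {N : Set ℝ}
    (hN : MeasurableSet N) (h0 : volume N = 0) :
    compoundPoisson ν N ≤ ENNReal.ofReal (Real.exp (-ν.real univ)) := by
  -- Every power with at least one factor `ν` is absolutely continuous; only the Dirac mass at `k =
  -- 0` can charge `N`, with weight `exp(-ν(ℝ))`.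
  have hk : ∀ k, convPow ν (k + 1) N = 0 := fun k =>
    Measure.conv_absolutelyContinuous hν h0
  rw [compoundPoisson, Measure.sum_apply _ hN, tsum_eq_single 0]
  · rw [Measure.smul_apply, smul_eq_mul]
    refine (mul_le_mul_right (prob_le_one (μ := Measure.dirac (0 : ℝ))) _).trans ?_
    simp
  · intro k hk0
    obtain ⟨j, rfl⟩ := Nat.exists_eq_succ_of_ne_zero hk0
    simp [hk]

/-! ### Weak limits of compound Poisson laws and the existence of Lévy-Khintchine laws. -/

section
variable {E : Type*} [NormedAddCommGroup E] [InnerProductSpace ℝ E] [FiniteDimensional ℝ E]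
  [MeasurableSpace E] [BorelSpace E]

/-- Lévy's continuity theorem. -/
theorem exists_tendsto_of_tendsto_charFun {μ : ℕ → ProbabilityMeasure E} {φ : E → ℂ}
    (hφ : ContinuousAt φ 0) 
    (h : ∀ t, Tendsto (fun n => charFun (μ n : Measure E) t) atTop (𝓝 (φ t))) :
    ∃ μ₀ : ProbabilityMeasure E, Tendsto μ atTop (𝓝 μ₀) ∧
      ∀ t, charFun (μ₀ : Measure E) t = φ t := by
  have ht : IsTightMeasureSet (range fun n => (μ n : Measure E)) :=
    isTightMeasureSet_of_tendsto_charFun hφ h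
  have hc : IsCompact (closure (range μ)) := by
    refine isCompact_closure_of_isTightMeasureSet ?_
    convert ht using 1
    ext; simp
  obtain ⟨μ₀, -, hμ₀⟩ := hc.exists_mapClusterPt (f := (atTop : Filter ℕ)) (u := μ)
    (tendsto_principal.2 (Eventually.of_forall fun n => subset_closure ⟨n, rfl⟩))
  -- Along an ultrafilter the cluster point is a genuine limit, so its characteristic function must
  -- be `φ`; convergence of the whole sequence then follows from that of the characteristic
  -- functions.
  obtain ⟨U, hU, hUμ⟩ := mapClusterPt_iff_ultrafilter.1 hμ₀
  have hφ' : ∀ t, charFun (μ₀ : Measure E) t = φ t := by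
    intro t
    refine tendsto_nhds_unique ?_ ((h t).mono_left hU)
    simp_rw [charFun_eq_integral_innerProbChar]
    exact (ProbabilityMeasure.tendsto_iff_forall_integral_rclike_tendsto ℂ).1 hUμ
      (BoundedContinuousFunction.innerProbChar t)
  refine ⟨μ₀, ProbabilityMeasure.tendsto_of_tendsto_charFun fun t => ?_, hφ'⟩
  rw [hφ']
  exact h t

end

section
variable {E : Type*} [NormedAddCommGroup E] [InnerProductSpace ℝ E] [FiniteDimensional ℝ E]
  [MeasurableSpace E] [BorelSpace E]

/-- The integrand of the Lévy-Khintchine exponent with compensator `h`. -/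
noncomputable def levyKernel (h : E → E) (z x : E) : ℂ :=
  Complex.exp (Complex.I * ((inner ℝ x z : ℝ) : ℂ)) - 1 - Complex.I * ((inner ℝ (h x) z : ℝ) : ℂ)

theorem continuous_levyKernel {E : Type*} [NormedAddCommGroup E] [InnerProductSpace ℝ E]
    (h : E → E) (x : E) : Continuous fun z => levyKernel h z x := by
  unfold levyKernel
  fun_prop

theorem measurable_levyKernel {h : E → E} (hh : Measurable h) (z : E) :
    Measurable (levyKernel h z) := by
  unfold levyKernel
  fun_prop

/-- The compound Poisson law with jump measure `ν`, compensated by `h`. -/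
noncomputable def compensatedPoisson (h : E → E) (ν : Measure E) : Measure E :=
  (compoundPoisson ν).map fun x => x + -∫ y, h y ∂ν

instance (h : E → E) (ν : Measure E) [IsFiniteMeasure ν] :
    IsProbabilityMeasure (compensatedPoisson h ν) :=
  Measure.isProbabilityMeasure_map (by fun_prop)

theorem charFun_compensatedPoisson {h : E → E} {ν : Measure E} [IsFiniteMeasure ν]
    (hh : Integrable h ν) (z : E) :
    charFun (compensatedPoisson h ν) z = Complex.exp (∫ x, levyKernel h z x ∂ν) := by
  have h1 : Integrable
      (fun x : E => Complex.exp (Complex.I * ((inner ℝ x z : ℝ) : ℂ)) - 1) ν := by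
    refine (Integrable.of_bound (by fun_prop) 1 (ae_of_all _ fun x => ?_)).sub (integrable_const _)
    rw [mul_comm, Complex.norm_exp_ofReal_mul_I]
  have h2 : Integrable (fun x : E => (inner ℝ (h x) z : ℝ)) ν := hh.inner_const z
  have h3 : ∫ x, (inner ℝ (h x) z : ℝ) ∂ν = inner ℝ (∫ x, h x ∂ν) z := by
    simp_rw [real_inner_comm z]
    exact integral_inner hh z
  have h4 : ∫ x, levyKernel h z x ∂ν
      = ∫ x, (Complex.exp (Complex.I * ((inner ℝ x z : ℝ) : ℂ)) - 1) ∂ν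
        - Complex.I * ((inner ℝ (∫ x, h x ∂ν) z : ℝ) : ℂ) := by
    rw [← h3, ← integral_complex_ofReal, ← integral_const_mul]
    exact integral_sub h1 (h2.ofReal.const_mul Complex.I)
  rw [compensatedPoisson, charFun_map_add_const, charFun_compoundPoisson, h4, ← Complex.exp_add,
    inner_neg_left]
  push_cast
  ring_nf

/-- The law with the exponent `∫ levyKernel h z x ν(dx)` is the weak limit of the compensated
compound Poisson laws whose jump measures exhaust `ν`. -/
theorem exists_tendsto_compensatedPoisson {ν : Measure E} {h : E → E} (hh : Measurable h)
    (hh1 : ∀ x, ‖h x‖ ≤ 1) {G : E → ℝ} (hG : Integrable G ν)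
    (hk : ∀ z x, ‖levyKernel h z x‖ ≤ (2 + 3 * ‖z‖ ^ 2) * G x)
    {A : ℕ → Set E} (hA : ∀ n, MeasurableSet (A n)) (hmono : Monotone A)
    (hfin : ∀ n, IsFiniteMeasure (ν.restrict (A n))) (hcov : ∀ᵐ x ∂ν, x ∈ ⋃ n, A n) :
    ∃ μ : ProbabilityMeasure E,
      Tendsto (β := ProbabilityMeasure E)
        (fun n => ⟨compensatedPoisson h (ν.restrict (A n)), inferInstance⟩) atTop (𝓝 μ) ∧
      ∀ z, charFun (μ : Measure E) z = Complex.exp (∫ x, levyKernel h z x ∂ν) := by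
  have hki : ∀ z, Integrable (levyKernel h z) ν := fun z =>
    (hG.const_mul _).mono' (measurable_levyKernel hh z).aestronglyMeasurable
      (ae_of_all _ (hk z))
  refine exists_tendsto_of_tendsto_charFun ?_ fun z => ?_
  · refine Complex.continuous_exp.continuousAt.comp ?_
    -- The constant is `2 + 3‖z‖² ≤ 5` on the unit ball.
    refine continuousAt_of_dominated (bound := fun x => 5 * G x)
      (Eventually.of_forall fun z => (hki z).aestronglyMeasurable) ?_ (hG.const_mul _)
      (ae_of_all _ fun x => (continuous_levyKernel h x).continuousAt)
    filter_upwards [Metric.ball_mem_nhds (0 : E) one_pos] with z hz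
    refine ae_of_all _ fun x => (hk z x).trans ?_
    have hz1 : ‖z‖ ^ 2 ≤ 1 := by
      rw [mem_ball_zero_iff] at hz
      nlinarith [norm_nonneg z]
    have hGx : 0 ≤ G x := by
      have := (norm_nonneg _).trans (hk 0 x)
      simp only [norm_zero] at this
      linarith
    nlinarith
  · have hA' : Tendsto (fun n => ∫ x in A n, levyKernel h z x ∂ν) atTop
        (𝓝 (∫ x in ⋃ n, A n, levyKernel h z x ∂ν)) :=
      tendsto_setIntegral_of_monotone hA hmono (hki z).integrableOn
    rw [Measure.restrict_eq_self_of_ae_mem hcov] at hA'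
    refine ((Complex.continuous_exp.tendsto _).comp hA').congr fun n => ?_
    exact (charFun_compensatedPoisson
      (Integrable.of_bound hh.aestronglyMeasurable 1 (ae_of_all _ hh1)) z).symm

/-- Taylor's estimate handles `|t| ≤ 1`; beyond that, `2 + |t| ≤ 3 t²`. This is the source of the
`3‖z‖²` in the kernel bounds. -/
theorem norm_cexp_I_mul_sub_one_sub_le (t : ℝ) :
    ‖Complex.exp (Complex.I * t) - 1 - Complex.I * t‖ ≤ 3 * t ^ 2 := by
  rcases le_total |t| 1 with h | h
  · have := Complex.norm_exp_sub_one_sub_id_le (x := Complex.I * t) (by simpa using h)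
    simp only [norm_mul, Complex.norm_I, one_mul, Complex.norm_real, Real.norm_eq_abs,
      sq_abs] at this
    nlinarith [sq_nonneg t]
  · have h1 : ‖Complex.exp (Complex.I * t) - 1 - Complex.I * t‖ ≤ 1 + 1 + |t| := by
      refine (norm_sub_le _ _).trans (add_le_add ((norm_sub_le _ _).trans ?_) ?_)
      · rw [mul_comm, Complex.norm_exp_ofReal_mul_I]; simp
      · simp
    rw [← sq_abs]
    nlinarith

theorem norm_cexp_I_mul_sub_one_le_two (t : ℝ) : ‖Complex.exp (Complex.I * t) - 1‖ ≤ 2 := by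
  refine (norm_sub_le _ _).trans ?_
  rw [mul_comm, Complex.norm_exp_ofReal_mul_I]
  norm_num

end

/-- Every Lévy measure is the Lévy measure of an infinitely divisible law without Gaussian part. -/
theorem IsLevyMeasure.exists_hasLevyTriplet {d : ℕ} {ν : Measure (EuclideanSpace ℝ (Fin d))}
    (hν : IsLevyMeasure ν) : ∃ μ, HasLevyTriplet μ 0 ν 0 := by
  classical
  set E := EuclideanSpace ℝ (Fin d)
  let h : E → E := fun x => if ‖x‖ ≤ 1 then x else 0
  have hh : Measurable h :=
    Measurable.ite (measurableSet_le measurable_norm measurable_const) measurable_id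
      measurable_const
  have hh1 : ∀ x, ‖h x‖ ≤ 1 := by
    intro x
    by_cases hx : ‖x‖ ≤ 1 <;> simp [h, hx]
  let G : E → ℝ := fun x => min (‖x‖ ^ 2) 1
  have hG0 : ∀ x, 0 ≤ G x := fun x => by positivity
  have hGm : Measurable G := by fun_prop
  have hG : Integrable G ν := by
    refine ⟨hGm.aestronglyMeasurable, ?_⟩
    rw [hasFiniteIntegral_iff_ofReal (ae_of_all _ hG0)]
    exact hν.2
  -- These sets have finite mass by Markov's inequality and exhaust the complement of the origin,
  -- which is `ν`-null.
  let A : ℕ → Set E := fun n => {x | 1 / ((n : ℝ) + 1) ≤ G x}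
  have hk : ∀ z x, ‖levyKernel h z x‖ ≤ (2 + 3 * ‖z‖ ^ 2) * G x := by
    intro z x
    by_cases hx : ‖x‖ ≤ 1
    · have hGx : G x = ‖x‖ ^ 2 := min_eq_left (by nlinarith [norm_nonneg x])
      have hi : (inner ℝ x z : ℝ) ^ 2 ≤ ‖x‖ ^ 2 * ‖z‖ ^ 2 := by
        rw [← mul_pow, ← sq_abs]
        exact pow_le_pow_left₀ (abs_nonneg _) (abs_real_inner_le_norm x z) 2
      have := norm_cexp_I_mul_sub_one_sub_le (inner ℝ x z)
      simp only [levyKernel, h, hx, if_true]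
      rw [hGx]
      nlinarith [sq_nonneg ‖x‖]
    · have hGx : G x = 1 := min_eq_right (by nlinarith [norm_nonneg x])
      have := norm_cexp_I_mul_sub_one_le_two (inner ℝ x z)
      simp only [levyKernel, h, hx, if_false, inner_zero_left, Complex.ofReal_zero, mul_zero,
        sub_zero]
      rw [hGx]
      nlinarith [sq_nonneg ‖z‖]
  obtain ⟨μ, -, hμ⟩ := exists_tendsto_compensatedPoisson (A := A) hh hh1 hG hk
    (fun n => measurableSet_le measurable_const hGm)
    (fun m n hmn x hx => le_trans (Nat.one_div_le_one_div hmn) (show 1 / ((m : ℝ) + 1) ≤ G x from hx))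
    (fun n => ⟨by
      rw [Measure.restrict_apply_univ]
      exact hG.measure_ge_lt_top (by positivity)⟩)
    (by
      have h0 : ∀ᵐ x ∂ν, x ≠ 0 := by
        simpa [ae_iff] using hν.1
      filter_upwards [h0] with x hx
      have hx' : 0 < G x := lt_min (by positivity) one_pos
      obtain ⟨n, hn⟩ := exists_nat_one_div_lt hx'
      exact mem_iUnion.2 ⟨n, hn.le⟩)
  refine ⟨μ, inferInstance, Matrix.PosSemidef.zero, hν, fun z => ?_⟩
  rw [hμ]
  congr 1
  simp only [Matrix.zero_mulVec, dotProduct_zero, Complex.ofReal_zero, mul_zero, inner_zero_left,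
    zero_add]
  refine integral_congr_ae (ae_of_all _ fun x => ?_)
  by_cases hx : ‖x‖ ≤ 1 <;> simp [levyKernel, h, hx]

/-- The tempered stable Lévy measures are exactly the images of the upsilon transform. -/
theorem LTS_eq_upsilonRange (d : ℕ) (α p : ℝ) : LTS d α p = upsilonRange d (psi α p) := by
  ext ν
  refine ⟨fun ⟨_, h⟩ => h.2, fun h => ?_⟩
  obtain ⟨M, hM, rfl⟩ := id h
  obtain ⟨μ, hμ⟩ := hM.2.exists_hasLevyTriplet
  exact ⟨μ, ⟨0, hμ⟩, h⟩


/-! ### Subordinators and the existence of stable densities. -/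

theorem levyKernel_zero (z x : ℝ) :
    levyKernel (fun _ : ℝ => (0 : ℝ)) z x = Complex.exp (Complex.I * ((x * z : ℝ) : ℂ)) - 1 := by
  simp [levyKernel, mul_comm]

/-- Jumps that integrate `|x| ∧ 1` need no compensator, since the kernel is already of first order
at the origin. The constant is generous, to fit `exists_tendsto_compensatedPoisson`. -/
theorem norm_levyKernel_zero_le (z x : ℝ) :
    ‖levyKernel (fun _ : ℝ => (0 : ℝ)) z x‖ ≤ (2 + 3 * ‖z‖ ^ 2) * min |x| 1 := by
  rw [levyKernel_zero]
  rcases le_total |x| 1 with h | h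
  · rw [min_eq_left h]
    refine (Real.norm_exp_I_mul_ofReal_sub_one_le).trans ?_
    rw [norm_mul, Real.norm_eq_abs x, mul_comm]
    refine mul_le_mul_of_nonneg_right ?_ (abs_nonneg x)
    nlinarith [sq_nonneg (‖z‖ - 1)]
  · rw [min_eq_right h]
    have := norm_cexp_I_mul_sub_one_le_two (x * z)
    nlinarith [sq_nonneg ‖z‖]

theorem compensatedPoisson_zero (ν : Measure ℝ) :
    compensatedPoisson (fun _ : ℝ => (0 : ℝ)) ν = compoundPoisson ν := by
  simp [compensatedPoisson]

theorem isFiniteMeasure_restrict_Ioi {ν : Measure ℝ}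
    (hG : Integrable (fun x : ℝ => min |x| 1) ν) {ε : ℝ} (hε : 0 < ε) :
    IsFiniteMeasure (ν.restrict (Ioi ε)) := by
  constructor
  rw [Measure.restrict_apply_univ]
  refine (measure_mono fun x hx => ?_).trans_lt (hG.measure_ge_lt_top (lt_min hε one_pos))
  exact min_le_min_right 1 ((mem_Ioi.1 hx).le.trans (le_abs_self x))

/-- The truncations of a measure on `(0, ∞)` away from zero give compound Poisson laws that converge
weakly. -/
theorem exists_tendsto_compoundPoisson {ν : Measure ℝ} (hpos : ∀ᵐ x ∂ν, 0 < x)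
    (hG : Integrable (fun x : ℝ => min |x| 1) ν) :
    ∃ μ : ProbabilityMeasure ℝ,
      (∀ f : BoundedContinuousFunction ℝ ℝ, Tendsto
        (fun n : ℕ => ∫ x, f x ∂(compoundPoisson (ν.restrict (Ioi (1 / ((n : ℝ) + 1))))))
        atTop (𝓝 (∫ x, f x ∂(μ : Measure ℝ)))) ∧
      ∀ z, charFun (μ : Measure ℝ) z
        = Complex.exp (∫ x, levyKernel (fun _ : ℝ => (0 : ℝ)) z x ∂ν) := by
  obtain ⟨μ, hμ, hc⟩ := exists_tendsto_compensatedPoisson (ν := ν)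
    (A := fun n : ℕ => Ioi (1 / ((n : ℝ) + 1))) (h := fun _ => 0) measurable_const (by simp) hG
    norm_levyKernel_zero_le (fun n => measurableSet_Ioi)
    (fun m n hmn => Ioi_subset_Ioi (Nat.one_div_le_one_div hmn))
    (fun n => isFiniteMeasure_restrict_Ioi hG (by positivity))
    (by
      filter_upwards [hpos] with x hx
      obtain ⟨n, hn⟩ := exists_nat_one_div_lt hx
      exact mem_iUnion.2 ⟨n, hn⟩)
  refine ⟨μ, fun f => ?_, hc⟩
  have := ProbabilityMeasure.tendsto_iff_forall_integral_tendsto.1 hμ f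
  simpa only [ProbabilityMeasure.coe_mk, compensatedPoisson_zero] using this

theorem ae_nonneg_compoundPoisson {ν : Measure ℝ} (hpos : ∀ᵐ x ∂ν, 0 < x) (ε : ℝ) :
    ∀ᵐ x ∂(compoundPoisson (ν.restrict (Ioi ε))), 0 ≤ x :=
  ae_mem_compoundPoisson (S := AddSubmonoid.nonneg ℝ) measurableSet_Ici
    ((ae_restrict_of_ae hpos).mono fun _ hx => le_of_lt hx)

theorem integrable_exp_neg_mul_sub_one {ν : Measure ℝ} (hpos : ∀ᵐ x ∂ν, 0 < x)
    (hG : Integrable (fun x : ℝ => min |x| 1) ν) {t : ℝ} (ht : 0 ≤ t) :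
    Integrable (fun x => Real.exp (-(t * x)) - 1) ν := by
  refine (hG.const_mul (1 + t)).mono' (by fun_prop) ?_
  filter_upwards [hpos] with x hx
  have h1 : Real.exp (-(t * x)) ≤ 1 := Real.exp_le_one_iff.2 (by nlinarith)
  have h2 := Real.add_one_le_exp (-(t * x))
  have h3 := Real.exp_pos (-(t * x))
  rw [Real.norm_eq_abs, abs_of_nonpos (by linarith), abs_of_pos hx]
  rcases le_total x 1 with h | h
  · rw [min_eq_left h]; nlinarith
  · rw [min_eq_right h]; nlinarith

theorem integral_exp_compoundPoisson {ν : Measure ℝ} (hpos : ∀ᵐ x ∂ν, 0 < x)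
    (hG : Integrable (fun x : ℝ => min |x| 1) ν) {t : ℝ} (ht : 0 ≤ t) {ε : ℝ} (hε : 0 < ε) :
    ∫ x, Real.exp (-(t * max x 0)) ∂(compoundPoisson (ν.restrict (Ioi ε)))
      = Real.exp (∫ x in Ioi ε, (Real.exp (-(t * x)) - 1) ∂ν) := by
  have := isFiniteMeasure_restrict_Ioi hG hε
  have hpos' : ∀ᵐ x ∂(ν.restrict (Ioi ε)), x ∈ AddSubmonoid.nonneg ℝ :=
    (ae_restrict_of_ae hpos).mono fun _ hx => le_of_lt hx
  -- Replacing `x` by `max x 0` makes the exponential bounded on the whole line; it stays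
  -- multiplicative on the half-line that carries the jumps.
  have key := integral_compoundPoisson (S := AddSubmonoid.nonneg ℝ) measurableSet_Ici hpos'
    (F := fun x => ((Real.exp (-(t * max x 0)) : ℝ) : ℂ)) (by fun_prop) (fun x => ?_) (by simp)
    (fun x hx y hy => ?_)
  · rw [integral_complex_ofReal] at key
    apply Complex.ofReal_injective
    rw [key, Complex.ofReal_exp, ← integral_complex_ofReal]
    congr 1
    refine integral_congr_ae ?_
    filter_upwards [hpos'] with x hx
    rw [max_eq_left hx]
    push_cast
    rfl
  · rw [Complex.norm_real, Real.norm_eq_abs, abs_of_pos (Real.exp_pos _)]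
    exact Real.exp_le_one_iff.2 (by have := le_max_right x 0; nlinarith)
  · rw [max_eq_left (add_nonneg hx hy), max_eq_left hx, max_eq_left hy, ← Complex.ofReal_mul,
      ← Real.exp_add]
    ring_nf

/-- The law at time one of the driftless subordinator with jump measure `ν` of infinite mass; it is
absolutely continuous if `ν` is. -/
theorem exists_subordinator {ν : Measure ℝ} (hpos : ∀ᵐ x ∂ν, 0 < x)
    (hG : Integrable (fun x : ℝ => min |x| 1) ν) (hac : ν ≪ volume) (htop : ν univ = ⊤) :
    ∃ μ : Measure ℝ, IsProbabilityMeasure μ ∧ μ ≪ volume ∧ (∀ᵐ x ∂μ, 0 < x) ∧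
      ∀ t, 0 ≤ t →
        ∫ x, Real.exp (-(t * x)) ∂μ = Real.exp (∫ x, (Real.exp (-(t * x)) - 1) ∂ν) := by
  obtain ⟨μ, hμ, hc⟩ := exists_tendsto_compoundPoisson hpos hG
  have hcov : (⋃ n : ℕ, Ioi (1 / ((n : ℝ) + 1))) = Ioi (0 : ℝ) := by
    ext x
    simp only [mem_iUnion, mem_Ioi]
    exact ⟨fun ⟨n, hn⟩ => lt_trans (by positivity) hn, exists_nat_one_div_lt⟩
  have hmono : Monotone fun n : ℕ => Ioi (1 / ((n : ℝ) + 1)) :=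
    fun m n hmn => Ioi_subset_Ioi (Nat.one_div_le_one_div hmn)
  have hrestr : ν.restrict (Ioi 0) = ν := Measure.restrict_eq_self_of_ae_mem hpos
  -- absolute continuity
  have hμac : (μ : Measure ℝ) ≪ volume := by
    refine Measure.AbsolutelyContinuous.mk fun N hN h0 => ?_
    -- Split off the jumps larger than `ε`: `μ` is the convolution of the law of the small jumps
    -- with a compound Poisson law, which charges translates of `N` by at most `exp(-ν(ε, ∞))`. As
    -- `ε` decreases to `0` this bound vanishes, the total jump mass being infinite.
    have hle : ∀ n : ℕ, (μ : Measure ℝ) N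
        ≤ ENNReal.ofReal (Real.exp (-(ν.restrict (Ioi (1 / ((n : ℝ) + 1)))).real univ)) := by
      intro n
      set ε : ℝ := 1 / ((n : ℝ) + 1)
      have hε : 0 < ε := by positivity
      have := isFiniteMeasure_restrict_Ioi hG hε
      obtain ⟨μ', -, hc'⟩ := exists_tendsto_compoundPoisson (ν := ν.restrict (Iic ε))
        (ae_restrict_of_ae hpos) hG.restrict
      have hki : ∀ z, Integrable (levyKernel (fun _ : ℝ => (0 : ℝ)) z) ν := fun z =>
        (hG.const_mul _).mono' (measurable_levyKernel measurable_const z).aestronglyMeasurable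
          (ae_of_all _ (norm_levyKernel_zero_le z))
      have hconv : (μ : Measure ℝ) = (μ' : Measure ℝ) ∗ compoundPoisson (ν.restrict (Ioi ε)) := by
        refine Measure.ext_of_charFun (funext fun z => ?_)
        rw [charFun_conv, hc, hc', ← compensatedPoisson_zero,
          charFun_compensatedPoisson (integrable_zero _ _ _), ← Complex.exp_add]
        congr 1
        rw [← integral_add_compl (measurableSet_Iic (a := ε)) (hki z), compl_Iic]
      rw [hconv, ← lintegral_indicator_one hN,
        Measure.lintegral_conv (measurable_one.indicator hN)]
      have hin : ∀ x, ∫⁻ y, N.indicator (1 : ℝ → ENNReal) (x + y)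
          ∂(compoundPoisson (ν.restrict (Ioi ε)))
          ≤ ENNReal.ofReal (Real.exp (-(ν.restrict (Ioi ε)).real univ)) := by
        intro x
        have hm : Measurable fun y : ℝ => x + y := measurable_const_add x
        have : (fun y => N.indicator (1 : ℝ → ENNReal) (x + y))
            = ((fun y => x + y) ⁻¹' N).indicator 1 := rfl
        rw [this, lintegral_indicator_one (hm hN)]
        refine compoundPoisson_null_le
          (Measure.absolutelyContinuous_of_le Measure.restrict_le_self |>.trans hac) (hm hN) ?_
        rw [measure_preimage_add, h0]
      refine (lintegral_mono hin).trans ?_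
      simp
    have hlim : Tendsto (fun n : ℕ => ν (Ioi (1 / ((n : ℝ) + 1)))) atTop (𝓝 ⊤) := by
      have := tendsto_measure_iUnion_atTop (μ := ν) hmono
      rwa [hcov, ← Measure.restrict_apply_univ, hrestr, htop] at this
    have hR : ∀ R : ℕ, (μ : Measure ℝ) N ≤ ENNReal.ofReal (Real.exp (-(R : ℝ))) := by
      intro R
      obtain ⟨n, hn⟩ := ((ENNReal.tendsto_nhds_top_iff_nat.1 hlim) R).exists
      refine (hle n).trans (ENNReal.ofReal_le_ofReal (Real.exp_le_exp.2 (neg_le_neg ?_)))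
      have := isFiniteMeasure_restrict_Ioi hG (ε := 1 / ((n : ℝ) + 1)) (by positivity)
      have h2 := measure_ne_top (ν.restrict (Ioi (1 / ((n : ℝ) + 1)))) univ
      rw [measureReal_def, ← ENNReal.toReal_natCast]
      refine ENNReal.toReal_mono h2 ?_
      rw [Measure.restrict_apply_univ]
      exact hn.le
    have hlim2 : Tendsto (fun R : ℕ => ENNReal.ofReal (Real.exp (-(R : ℝ)))) atTop (𝓝 0) := by
      rw [← ENNReal.ofReal_zero]
      exact ENNReal.tendsto_ofReal (Real.tendsto_exp_neg_atTop_nhds_zero.comp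
        tendsto_natCast_atTop_atTop)
    exact le_antisymm (ge_of_tendsto' hlim2 hR) bot_le
  -- support
  have hnonneg : ∀ᵐ x ∂(μ : Measure ℝ), 0 ≤ x := by
    -- A bounded continuous function that vanishes exactly on `[0, ∞)`, so that weak convergence
    -- carries the support over to the limit.
    let f : BoundedContinuousFunction ℝ ℝ := BoundedContinuousFunction.ofNormedAddCommGroup
      (fun x => min 1 (max (-x) 0)) (by fun_prop) 1 (fun x => by
        rw [Real.norm_eq_abs, abs_of_nonneg (by positivity)]
        exact min_le_left _ _)
    have h0 : ∫ x, f x ∂(μ : Measure ℝ) = 0 := by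
      refine tendsto_nhds_unique (hμ f) (tendsto_const_nhds.congr fun n => ?_)
      refine (integral_eq_zero_of_ae ?_).symm
      filter_upwards [ae_nonneg_compoundPoisson hpos _] with x hx
      change min 1 (max (-x) 0) = 0
      rw [max_eq_right (by linarith), min_eq_right zero_le_one]
    have h1 := (integral_eq_zero_iff_of_nonneg_ae (ae_of_all _ fun x => by
      change 0 ≤ min 1 (max (-x) 0)
      positivity) (f.integrable _)).1 h0
    filter_upwards [h1] with x hx
    by_contra hneg
    have : 0 < min 1 (max (-x) 0) := lt_min one_pos (lt_max_of_lt_left (by linarith))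
    exact this.ne' hx
  have hne : ∀ᵐ x ∂(μ : Measure ℝ), x ≠ 0 := by
    have : (μ : Measure ℝ) {0} = 0 := hμac (by simp)
    simpa [ae_iff] using this
  refine ⟨μ, inferInstance, hμac, ?_, fun t ht => ?_⟩
  · filter_upwards [hnonneg, hne] with x h1 h2 using lt_of_le_of_ne h1 h2.symm
  · let f : BoundedContinuousFunction ℝ ℝ := BoundedContinuousFunction.ofNormedAddCommGroup
      (fun x => Real.exp (-(t * max x 0))) (by fun_prop) 1 (fun x => by
        rw [Real.norm_eq_abs, abs_of_pos (Real.exp_pos _)]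
        exact Real.exp_le_one_iff.2 (by have := le_max_right x 0; nlinarith))
    have h1 : ∫ x, Real.exp (-(t * x)) ∂(μ : Measure ℝ) = ∫ x, f x ∂(μ : Measure ℝ) := by
      refine integral_congr_ae ?_
      filter_upwards [hnonneg] with x hx
      change _ = Real.exp (-(t * max x 0))
      rw [max_eq_left hx]
    rw [h1]
    refine tendsto_nhds_unique (hμ f) ?_
    have h2 := tendsto_setIntegral_of_monotone (μ := ν) (fun n => measurableSet_Ioi) hmono
      (integrable_exp_neg_mul_sub_one hpos hG ht).integrableOn
    rw [hcov, hrestr] at h2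
    refine ((Real.continuous_exp.tendsto _).comp h2).congr fun n => ?_
    exact (integral_exp_compoundPoisson hpos hG ht (by positivity)).symm

/-- The jump measure `c⁻¹ x^(-1-r) dx` of the stable subordinator, up to the choice of `c`. -/
noncomputable def stableJumps (r c : ℝ) : Measure ℝ :=
  (volume.restrict (Ioi (0 : ℝ))).withDensity fun x => ENNReal.ofReal (c⁻¹ * x ^ (-1 - r))

theorem integral_stableJumps {r c : ℝ} (hc : 0 < c) (f : ℝ → ℝ) :
    ∫ x, f x ∂(stableJumps r c) = c⁻¹ * ∫ x in Ioi (0 : ℝ), x ^ (-1 - r) * f x := by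
  rw [stableJumps, integral_withDensity_eq_integral_toReal_smul (by fun_prop)
    (ae_of_all _ fun x => ENNReal.ofReal_lt_top), ← integral_const_mul]
  refine setIntegral_congr_fun measurableSet_Ioi fun x hx => ?_
  have hx' : (0 : ℝ) < x := hx
  rw [ENNReal.toReal_ofReal (by positivity), smul_eq_mul, mul_assoc]

theorem integrableOn_rpow_mul_min {r : ℝ} (h0 : 0 < r) (h1 : r < 1) :
    IntegrableOn (fun x : ℝ => x ^ (-1 - r) * min |x| 1) (Ioi 0) := by
  rw [← Ioc_union_Ioi_eq_Ioi zero_le_one]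
  refine IntegrableOn.union ?_ ?_
  · have h : IntegrableOn (fun x : ℝ => x ^ (-r)) (Ioc 0 1) := by
      rw [← intervalIntegrable_iff_integrableOn_Ioc_of_le zero_le_one]
      exact intervalIntegral.intervalIntegrable_rpow' (by linarith)
    refine h.congr_fun (fun x hx => ?_) measurableSet_Ioc
    dsimp only
    rw [abs_of_pos hx.1, min_eq_left hx.2, ← Real.rpow_add_one hx.1.ne']
    ring_nf
  · refine (integrableOn_Ioi_rpow_of_lt (a := -1 - r) (by linarith) one_pos).congr_fun
      (fun x hx => ?_) measurableSet_Ioi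
    have hx' : (1 : ℝ) < x := hx
    dsimp only
    rw [abs_of_pos (by linarith), min_eq_right hx'.le, mul_one]

theorem integrableOn_rpow_mul_one_sub_exp {r : ℝ} (h0 : 0 < r) (h1 : r < 1) :
    IntegrableOn (fun x : ℝ => x ^ (-1 - r) * (1 - Real.exp (-x))) (Ioi 0) := by
  refine (integrableOn_rpow_mul_min h0 h1).mono' (by fun_prop) ?_
  refine ae_restrict_of_forall_mem measurableSet_Ioi fun x hx => ?_
  have hx' : (0 : ℝ) < x := hx
  have e1 : Real.exp (-x) ≤ 1 := Real.exp_le_one_iff.2 (by linarith)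
  have e2 := Real.add_one_le_exp (-x)
  have e3 := Real.exp_pos (-x)
  rw [norm_mul, Real.norm_of_nonneg (by positivity), Real.norm_of_nonneg (by linarith),
    abs_of_pos hx']
  exact mul_le_mul_of_nonneg_left (le_min (by linarith) (by linarith)) (by positivity)

theorem integral_rpow_mul_one_sub_exp_pos {r : ℝ} (h0 : 0 < r) (h1 : r < 1) :
    0 < ∫ x in Ioi (0 : ℝ), x ^ (-1 - r) * (1 - Real.exp (-x)) := by
  have hpos : ∀ x ∈ Ioi (0 : ℝ), 0 < x ^ (-1 - r) * (1 - Real.exp (-x)) := by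
    intro x hx
    have hx' : (0 : ℝ) < x := hx
    have e1 : Real.exp (-x) < 1 := by rw [← Real.exp_zero]; exact Real.exp_lt_exp.2 (by linarith)
    have := Real.rpow_pos_of_pos hx' (-1 - r)
    exact mul_pos this (by linarith)
  rw [setIntegral_pos_iff_support_of_nonneg_ae
    (ae_restrict_of_forall_mem measurableSet_Ioi fun x hx => (hpos x hx).le)
    (integrableOn_rpow_mul_one_sub_exp h0 h1)]
  refine lt_of_lt_of_le ?_ (measure_mono (show Ioi (0 : ℝ) ⊆ _ from
    fun x hx => ⟨(hpos x hx).ne', hx⟩))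
  simp

/-- Homogeneity of `x^(-1-r)` under the substitution `x ↦ t x` produces the power `t^r`. -/
theorem integral_rpow_mul_exp_sub_one {r : ℝ} (h0 : 0 < r) {t : ℝ} (ht : 0 ≤ t) :
    ∫ x in Ioi (0 : ℝ), x ^ (-1 - r) * (Real.exp (-(t * x)) - 1)
      = -(t ^ r * ∫ x in Ioi (0 : ℝ), x ^ (-1 - r) * (1 - Real.exp (-x))) := by
  rcases ht.eq_or_lt with rfl | ht
  · simp [Real.zero_rpow h0.ne']
  have := integral_comp_mul_left_Ioi (fun x : ℝ => x ^ (-1 - r) * (1 - Real.exp (-x))) 0 ht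
  rw [mul_zero, smul_eq_mul, eq_inv_mul_iff_mul_eq₀ ht.ne'] at this
  rw [← this, ← integral_const_mul, ← integral_const_mul, ← integral_neg]
  refine setIntegral_congr_fun measurableSet_Ioi fun x hx => ?_
  have hx' : (0 : ℝ) < x := hx
  rw [Real.mul_rpow ht.le hx'.le]
  have e : t ^ r * t * t ^ (-1 - r) = 1 := by
    rw [← Real.rpow_add_one ht.ne', ← Real.rpow_add ht,
      show r + 1 + (-1 - r) = 0 by ring, Real.rpow_zero]
  linear_combination (-(x ^ (-1 - r) * (Real.exp (-(t * x)) - 1))) * e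

/-- The law is that of the driftless subordinator with jumps `c⁻¹ x^(-1-r) dx`, where `c` normalises
the exponent to `-t^r`. Small jumps are summable because `r < 1`, and their number is infinite,
which yields a Radon-Nikodym density. -/
theorem exists_isStableDensity {r : ℝ} (h0 : 0 < r) (h1 : r < 1) : ∃ f, IsStableDensity r f := by
  set c := ∫ x in Ioi (0 : ℝ), x ^ (-1 - r) * (1 - Real.exp (-x)) with hc_def
  have hc : 0 < c := integral_rpow_mul_one_sub_exp_pos h0 h1
  have hac : stableJumps r c ≪ volume.restrict (Ioi (0 : ℝ)) := withDensity_absolutelyContinuous _ _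
  have hpos : ∀ᵐ x ∂(stableJumps r c), 0 < x := hac (ae_restrict_mem measurableSet_Ioi)
  have hG : Integrable (fun x : ℝ => min |x| 1) (stableJumps r c) := by
    rw [stableJumps, integrable_withDensity_iff_integrable_smul' (by fun_prop)
      (ae_of_all _ fun x => ENNReal.ofReal_lt_top)]
    refine IntegrableOn.congr_fun ((integrableOn_rpow_mul_min h0 h1).const_mul c⁻¹) (fun x hx => ?_)
      measurableSet_Ioi
    have hx' : (0 : ℝ) < x := hx
    rw [ENNReal.toReal_ofReal (by positivity), smul_eq_mul, mul_assoc]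
  have htop : stableJumps r c univ = ⊤ := by
    by_contra hfin
    refine not_integrableOn_Ioi_rpow (-1 - r) ?_
    have : Integrable (fun _ : ℝ => (1 : ℝ)) (stableJumps r c) :=
      integrable_const_iff.2 (Or.inr ⟨lt_top_iff_ne_top.2 hfin⟩)
    rw [stableJumps, integrable_withDensity_iff_integrable_smul' (by fun_prop)
      (ae_of_all _ fun x => ENNReal.ofReal_lt_top)] at this
    refine IntegrableOn.congr_fun (this.const_mul c) (fun x hx => ?_) measurableSet_Ioi
    have hx' : (0 : ℝ) < x := hx
    rw [ENNReal.toReal_ofReal (by positivity), smul_eq_mul, mul_one, mul_inv_cancel_left₀ hc.ne']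
  obtain ⟨μ, hμp, hμac, hμpos, hμ⟩ := exists_subordinator hpos hG
    (hac.trans (Measure.absolutelyContinuous_of_le Measure.restrict_le_self)) htop
  refine ⟨fun x => (μ.rnDeriv volume x).toReal, (Measure.measurable_rnDeriv _ _).ennreal_toReal,
    fun x _ => ENNReal.toReal_nonneg, fun t ht => ?_⟩
  have hL := hμ t ht
  rw [integral_stableJumps hc, integral_rpow_mul_exp_sub_one h0 ht, ← hc_def, mul_neg,
    mul_comm (t ^ r), inv_mul_cancel_left₀ hc.ne'] at hL
  have hr : ∫ x, Real.exp (-(t * x)) ∂μ = ∫ x in Ioi (0 : ℝ), Real.exp (-(t * x)) ∂μ := by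
    rw [Measure.restrict_eq_self_of_ae_mem (s := Ioi (0 : ℝ)) hμpos]
  rw [← hL, hr, ← setIntegral_rnDeriv_smul hμac measurableSet_Ioi]
  simp [mul_comm]

theorem isStableDensity_stableDensity {r : ℝ} (h0 : 0 < r) (h1 : r < 1) :
    IsStableDensity r (stableDensity r) :=
  Classical.epsilon_spec (exists_isStableDensity h0 h1)


/-! ### Composition of upsilon transforms and the two convolution identities. -/

instance {d : ℕ} (ρ : Measure ℝ) (M : Measure (EuclideanSpace ℝ (Fin d))) [SFinite ρ] [SFinite M] :
    SFinite (upsilon ρ M) := by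
  unfold upsilon
  infer_instance

instance (α p : ℝ) : SFinite (psi α p) := by
  unfold psi
  infer_instance

theorem lintegral_upsilon {d : ℕ} (ρ : Measure ℝ) (M : Measure (EuclideanSpace ℝ (Fin d)))
    [SFinite M] {f : EuclideanSpace ℝ (Fin d) → ENNReal} (hf : Measurable f) :
    ∫⁻ y, f y ∂(upsilon ρ M) = ∫⁻ s, ∫⁻ x, f (s • x) ∂M ∂ρ := by
  rw [upsilon, lintegral_map hf (by fun_prop), lintegral_prod _ (by fun_prop)]

/-- Upsilon transforms compose by multiplicative convolution of the dilation measures. -/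
theorem upsilon_upsilon {d : ℕ} {ρ₁ ρ₂ ρ₃ : Measure ℝ} [SFinite ρ₂]
    (M : Measure (EuclideanSpace ℝ (Fin d))) [SFinite M]
    (h : ∀ g : ℝ → ENNReal, Measurable g → ∫⁻ s, ∫⁻ u, g (s * u) ∂ρ₂ ∂ρ₁ = ∫⁻ t, g t ∂ρ₃) :
    upsilon ρ₁ (upsilon ρ₂ M) = upsilon ρ₃ M := by
  refine Measure.ext_of_lintegral _ fun f hf => ?_
  rw [lintegral_upsilon _ _ hf, lintegral_upsilon _ _ hf,
    ← h (fun t => ∫⁻ x, f (t • x) ∂M) (Measurable.lintegral_prod_right'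
      (f := fun z : ℝ × EuclideanSpace ℝ (Fin d) => f (z.1 • z.2)) (by fun_prop))]
  refine lintegral_congr fun s => ?_
  rw [lintegral_upsilon _ _ (by fun_prop)]
  simp_rw [mul_smul]

theorem setLIntegral_Ioi_comp_div (F : ℝ → ENNReal) {s : ℝ} (hs : 0 < s) :
    ∫⁻ u in Ioi (0 : ℝ), F u = ∫⁻ t in Ioi (0 : ℝ), ENNReal.ofReal s⁻¹ * F (t / s) := by
  have him : (fun t : ℝ => t / s) '' Ioi 0 = Ioi 0 := by
    ext y
    constructor
    · rintro ⟨t, ht, rfl⟩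
      exact div_pos ht hs
    · exact fun hy => ⟨y * s, mul_pos hy hs, mul_div_cancel_right₀ y hs.ne'⟩
  rw [← him, lintegral_image_eq_lintegral_abs_deriv_mul measurableSet_Ioi
    (fun t _ => ((hasDerivAt_id' t).div_const s).hasDerivWithinAt)
    (fun a _ b _ hab => (div_left_inj' hs.ne').1 hab), him]
  simp [abs_of_pos hs]

theorem lintegral_restrict_withDensity {S : Set ℝ} {a g : ℝ → ENNReal} (ha : Measurable a)
    (hg : Measurable g) :
    ∫⁻ s, g s ∂((volume.restrict S).withDensity a) = ∫⁻ s in S, a s * g s := by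
  rw [lintegral_withDensity_eq_lintegral_mul _ ha hg]
  rfl

/-- The density of a multiplicative convolution of two measures on `(0, ∞)`. -/
theorem lintegral_lintegral_mul_withDensity {S : Set ℝ} (hS : MeasurableSet S) (hS0 : S ⊆ Ioi 0)
    {a b c : ℝ → ENNReal} (ha : Measurable a) (hb : Measurable b) (hc : Measurable c)
    (h : ∀ t, 0 < t → ∫⁻ s in S, a s * (ENNReal.ofReal s⁻¹ * b (t / s)) = c t)
    {g : ℝ → ENNReal} (hg : Measurable g) :
    ∫⁻ s, ∫⁻ u, g (s * u) ∂((volume.restrict (Ioi (0 : ℝ))).withDensity b)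
        ∂((volume.restrict S).withDensity a)
      = ∫⁻ t, g t ∂((volume.restrict (Ioi (0 : ℝ))).withDensity c) := by
  have hm : Measurable fun s => ∫⁻ u, g (s * u)
      ∂((volume.restrict (Ioi (0 : ℝ))).withDensity b) :=
    Measurable.lintegral_prod_right' (f := fun z : ℝ × ℝ => g (z.1 * z.2)) (by fun_prop)
  rw [lintegral_restrict_withDensity ha hm, lintegral_restrict_withDensity hc hg]
  calc ∫⁻ s in S, a s * ∫⁻ u, g (s * u) ∂((volume.restrict (Ioi (0 : ℝ))).withDensity b)
      = ∫⁻ s in S, ∫⁻ t in Ioi (0 : ℝ), a s * (ENNReal.ofReal s⁻¹ * b (t / s)) * g t := by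
        refine setLIntegral_congr_fun hS fun s hs => ?_
        have hs0 : 0 < s := hS0 hs
        -- Substitute `t = s u`; the Jacobian is the factor `s⁻¹` in `h`. Tonelli then allows
        -- integrating out `s`.
        rw [lintegral_restrict_withDensity hb (by fun_prop), setLIntegral_Ioi_comp_div _ hs0,
          ← lintegral_const_mul _ (by fun_prop)]
        refine lintegral_congr fun t => ?_
        rw [mul_div_cancel₀ t hs0.ne']
        ring
    _ = ∫⁻ t in Ioi (0 : ℝ), ∫⁻ s in S, a s * (ENNReal.ofReal s⁻¹ * b (t / s)) * g t := by
        refine lintegral_lintegral_swap ?_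
        exact Measurable.aemeasurable (by fun_prop)
    _ = ∫⁻ t in Ioi (0 : ℝ), c t * g t := by
        refine setLIntegral_congr_fun measurableSet_Ioi fun t ht => ?_
        rw [lintegral_mul_const _ (by fun_prop), h t ht]

theorem tauConst_eq {β α p : ℝ} (hβ : β < α) (hp : 0 < p) :
    tauConst β α p = 1 / p * Real.Gamma ((α - β) / p) := by
  rw [tauConst, integral_rpow_mul_exp_neg_rpow hp (by linarith)]
  ring_nf

theorem lintegral_gamma {γ : ℝ} (hγ : 0 < γ) :
    ∫⁻ v in Ioi (0 : ℝ), ENNReal.ofReal (Real.exp (-v) * v ^ (γ - 1))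
      = ENNReal.ofReal (Real.Gamma γ) := by
  rw [Real.Gamma_eq_integral hγ, ofReal_integral_eq_lintegral_ofReal
    (Real.GammaIntegral_convergent hγ)]
  refine ae_restrict_of_forall_mem measurableSet_Ioi fun v hv => ?_
  have : (0 : ℝ) < v := hv
  positivity

theorem image_rpow_neg_Ioi {p : ℝ} (hp : 0 < p) :
    (fun s : ℝ => s ^ (-p)) '' Ioi 0 = Ioi 0 := by
  ext y
  constructor
  · rintro ⟨s, hs, rfl⟩
    exact Real.rpow_pos_of_pos hs _
  · intro hy
    refine ⟨y ^ (-p)⁻¹, Real.rpow_pos_of_pos hy _, ?_⟩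
    exact Real.rpow_inv_rpow (le_of_lt hy) (neg_ne_zero.2 hp.ne')

theorem image_rpow_neg_sub_one_Ioo {p c : ℝ} (hp : 0 < p) (hc : 0 < c) :
    (fun s : ℝ => c * (s ^ (-p) - 1)) '' Ioo 0 1 = Ioi 0 := by
  ext y
  constructor
  · rintro ⟨s, hs, rfl⟩
    have := Real.one_lt_rpow_of_pos_of_lt_one_of_neg hs.1 hs.2 (neg_lt_zero.2 hp)
    exact mul_pos hc (by linarith)
  · intro hy
    have hy' : (0 : ℝ) < y := hy
    have h1 : 1 < y / c + 1 := by
      have := div_pos hy' hc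
      linarith
    refine ⟨(y / c + 1) ^ (-p)⁻¹, ⟨Real.rpow_pos_of_pos (by linarith) _,
      Real.rpow_lt_one_of_one_lt_of_neg h1 (inv_lt_zero.2 (neg_lt_zero.2 hp))⟩, ?_⟩
    dsimp only
    rw [Real.rpow_inv_rpow (by linarith) (neg_ne_zero.2 hp.ne')]
    field_simp
    ring

theorem injOn_rpow_neg {p : ℝ} (hp : 0 < p) : InjOn (fun s : ℝ => s ^ (-p)) (Ioi 0) :=
  fun _ ha _ hb hab =>
    (Real.rpow_left_inj (le_of_lt ha) (le_of_lt hb) (neg_ne_zero.2 hp.ne')).1 hab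

/-- The substitution `v = t^p (s^(-p) - 1)` maps `(0, 1)` onto `(0, ∞)` and gives `(t/s)^p = t^p +
v`. So `exp(-t^p)` factors out and the rest is a Gamma integral with parameter `γ = (α-β)/p`,
cancelled by `K = Γ(γ)/p`. -/
theorem lintegral_tau_density {β α p : ℝ} (hβ : β < α) (hp : 0 < p) {t : ℝ} (ht : 0 < t) :
    ∫⁻ s in Ioo (0 : ℝ) 1, ENNReal.ofReal
        (1 / tauConst β α p * s ^ (-α - 1) * (1 - s ^ p) ^ ((α - β) / p - 1)) *
        (ENNReal.ofReal s⁻¹ * ENNReal.ofReal ((t / s) ^ (-β - 1) * Real.exp (-((t / s) ^ p))))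
      = ENNReal.ofReal (t ^ (-α - 1) * Real.exp (-(t ^ p))) := by
  set γ := (α - β) / p with hγ_def
  have hγ : 0 < γ := div_pos (by linarith) hp
  have hpγ : p * γ = α - β := by rw [hγ_def]; field_simp
  have hΓ := Real.Gamma_pos_of_pos hγ
  have hK : tauConst β α p = 1 / p * Real.Gamma γ := tauConst_eq hβ hp
  have htp : 0 < t ^ p := Real.rpow_pos_of_pos ht p
  have hder : ∀ s ∈ Ioo (0 : ℝ) 1, HasDerivWithinAt (fun s : ℝ => t ^ p * (s ^ (-p) - 1))
      (t ^ p * (-p * s ^ (-p - 1))) (Ioo 0 1) s := fun s hs =>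
    (((Real.hasDerivAt_rpow_const (Or.inl hs.1.ne')).sub_const 1).const_mul _).hasDerivWithinAt
  have hinj : InjOn (fun s : ℝ => t ^ p * (s ^ (-p) - 1)) (Ioo 0 1) := by
    intro a ha b hb hab
    refine injOn_rpow_neg hp ha.1 hb.1 ?_
    have := mul_left_cancel₀ htp.ne' hab
    dsimp only at this ⊢
    linarith
  have hsub := lintegral_image_eq_lintegral_abs_deriv_mul measurableSet_Ioo hder hinj
    (fun v => ENNReal.ofReal (Real.exp (-v) * v ^ (γ - 1)))
  rw [image_rpow_neg_sub_one_Ioo hp htp, lintegral_gamma hγ] at hsub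
  have hfac : ENNReal.ofReal (t ^ (-α - 1) * Real.exp (-(t ^ p)))
      = ENNReal.ofReal (t ^ (-α - 1) * Real.exp (-(t ^ p)) / Real.Gamma γ)
        * ENNReal.ofReal (Real.Gamma γ) := by
    rw [← ENNReal.ofReal_mul (by positivity), div_mul_cancel₀ _ hΓ.ne']
  rw [hfac, hsub, ← lintegral_const_mul _ (by fun_prop)]
  refine setLIntegral_congr_fun measurableSet_Ioo fun s hs => ?_
  have hs0 : 0 < s := hs.1
  have hsp : 0 < s ^ p := Real.rpow_pos_of_pos hs0 p
  have hsp1 : 0 < 1 - s ^ p := sub_pos.2 (Real.rpow_lt_one hs0.le hs.2 hp)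
  have hKpos : 0 < tauConst β α p := by rw [hK]; positivity
  have hdpos : 0 < p * s ^ (-p - 1) := mul_pos hp (Real.rpow_pos_of_pos hs0 _)
  have habs : |t ^ p * (-p * s ^ (-p - 1))| = t ^ p * (p * s ^ (-p - 1)) := by
    rw [abs_of_neg (by nlinarith [mul_pos htp hdpos])]
    ring
  have hφ : t ^ p * (s ^ (-p) - 1) = t ^ p * s ^ (-p) * (1 - s ^ p) := by
    rw [Real.rpow_neg hs0.le]
    field_simp
  have hsnp : 0 < s ^ (-p) := Real.rpow_pos_of_pos hs0 _
  rw [habs, ← ENNReal.ofReal_mul (by positivity), ← ENNReal.ofReal_mul (by positivity),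
    ← ENNReal.ofReal_mul (by positivity), ← ENNReal.ofReal_mul (by positivity)]
  congr 1
  have hexp : Real.exp (-(t ^ p * (s ^ (-p) - 1))) * Real.exp (-(t ^ p))
      = Real.exp (-((t / s) ^ p)) := by
    rw [← Real.exp_add, Real.div_rpow ht.le hs0.le, Real.rpow_neg hs0.le]
    congr 1
    field_simp
    ring
  rw [← hexp]
  have hpow : (t ^ p * (s ^ (-p) - 1)) ^ (γ - 1)
      = t ^ (α - β - p) * s ^ (-(α - β - p)) * (1 - s ^ p) ^ (γ - 1) := by
    rw [hφ, Real.mul_rpow (by positivity) hsp1.le, Real.mul_rpow htp.le hsnp.le,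
      ← Real.rpow_mul ht.le, ← Real.rpow_mul hs0.le]
    congr 3
    · linear_combination hpγ
    · linear_combination -hpγ
  have hts : (t / s) ^ (-β - 1) = t ^ (-β - 1) * s ^ (β + 1) := by
    rw [Real.div_rpow ht.le hs0.le, div_eq_mul_inv, ← Real.rpow_neg hs0.le]
    congr 2
    ring
  have hs1 : s ^ (-α - 1) * s⁻¹ * s ^ (β + 1) = s ^ (-p - 1) * s ^ (-(α - β - p)) := by
    rw [← Real.rpow_neg_one, ← Real.rpow_add hs0, ← Real.rpow_add hs0, ← Real.rpow_add hs0]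
    congr 1
    ring
  have ht1 : t ^ (-β - 1) = t ^ (-α - 1) * t ^ p * t ^ (α - β - p) := by
    rw [← Real.rpow_add ht, ← Real.rpow_add ht]
    congr 1
    ring
  rw [hpow, hts, ht1, hK]
  set e := Real.exp (-(t ^ p * (s ^ (-p) - 1))) * Real.exp (-(t ^ p)) with he
  have he' : Real.exp (-(t ^ p)) * Real.exp (-(t ^ p * (s ^ (-p) - 1))) = e := by
    rw [he]; ring
  have : p / Real.Gamma γ * (1 / p * Real.Gamma γ) = 1 := by field_simp
  have hK' : 1 / (1 / p * Real.Gamma γ) = p / Real.Gamma γ := by field_simp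
  rw [hK']
  calc _ = p / Real.Gamma γ * (s ^ (-α - 1) * s⁻¹ * s ^ (β + 1)) * (1 - s ^ p) ^ (γ - 1)
        * (t ^ (-α - 1) * t ^ p * t ^ (α - β - p)) * e := by ring
    _ = _ := by rw [hs1, he]; ring

theorem lintegral_tau_psi {β α p : ℝ} (hβ : β < α) (hp : 0 < p) {g : ℝ → ENNReal}
    (hg : Measurable g) :
    ∫⁻ s, ∫⁻ u, g (s * u) ∂(psi β p) ∂(tau β α p) = ∫⁻ t, g t ∂(psi α p) :=
  lintegral_lintegral_mul_withDensity measurableSet_Ioo Ioo_subset_Ioi_self (by fun_prop)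
    (by fun_prop) (by fun_prop) (fun _ ht => lintegral_tau_density hβ hp ht) hg

theorem IsStableDensity.lintegral_eq {r : ℝ} {f : ℝ → ℝ} (hf : IsStableDensity r f) {t : ℝ}
    (ht : 0 ≤ t) :
    ∫⁻ x in Ioi (0 : ℝ), ENNReal.ofReal (Real.exp (-(t * x)) * f x)
      = ENNReal.ofReal (Real.exp (-(t ^ r))) := by
  rw [← hf.2.2 t ht, ofReal_integral_eq_lintegral_ofReal]
  -- `IsStableDensity` does not demand integrability, but a non-integrable function would have
  -- Bochner integral `0`, whereas the prescribed value is positive.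
  · by_contra hni
    exact (Real.exp_pos _).ne' ((hf.2.2 t ht).symm.trans (integral_undef hni))
  · exact ae_restrict_of_forall_mem measurableSet_Ioi fun x hx =>
      mul_nonneg (Real.exp_pos _).le (hf.2.1 x hx)

/-- With `x = s^(-p)` the integral becomes the Laplace transform of the `q/p`-stable density at
`t^p`, and `(t^p)^(q/p) = t^q`. -/
theorem lintegral_piMeasure_density {α p q : ℝ} (hq : 0 < q) (hqp : q < p) {t : ℝ} (ht : 0 < t) :
    ∫⁻ s in Ioi (0 : ℝ), ENNReal.ofReal
        (p * stableDensity (q / p) (s ^ (-p)) * s ^ (-α - p - 1)) *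
        (ENNReal.ofReal s⁻¹ * ENNReal.ofReal ((t / s) ^ (-α - 1) * Real.exp (-((t / s) ^ p))))
      = ENNReal.ofReal (t ^ (-α - 1) * Real.exp (-(t ^ q))) := by
  have hp : 0 < p := hq.trans hqp
  have hf := isStableDensity_stableDensity (div_pos hq hp) ((div_lt_one hp).2 hqp)
  have hfm : Measurable (stableDensity (q / p)) := hf.1
  have htp : 0 < t ^ p := Real.rpow_pos_of_pos ht p
  have hsub := lintegral_image_eq_lintegral_abs_deriv_mul measurableSet_Ioi
    (fun s (hs : s ∈ Ioi (0 : ℝ)) =>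
      (Real.hasDerivAt_rpow_const (p := -p) (Or.inl (ne_of_gt hs))).hasDerivWithinAt)
    (injOn_rpow_neg hp)
    (fun x => ENNReal.ofReal (Real.exp (-(t ^ p * x)) * stableDensity (q / p) x))
  rw [image_rpow_neg_Ioi hp, hf.lintegral_eq htp.le, ← Real.rpow_mul ht.le,
    mul_div_cancel₀ q hp.ne'] at hsub
  rw [ENNReal.ofReal_mul (by positivity), hsub, ← lintegral_const_mul _ (by fun_prop)]
  refine setLIntegral_congr_fun measurableSet_Ioi fun s hs => ?_
  have hs0 : 0 < s := hs
  have hfs : 0 ≤ stableDensity (q / p) (s ^ (-p)) := hf.2.1 _ (Real.rpow_pos_of_pos hs0 _)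
  have habs : |-p * s ^ (-p - 1)| = p * s ^ (-p - 1) := by
    rw [neg_mul, abs_neg, abs_of_pos (mul_pos hp (Real.rpow_pos_of_pos hs0 _))]
  rw [habs, ← ENNReal.ofReal_mul (by positivity), ← ENNReal.ofReal_mul (by positivity),
    ← ENNReal.ofReal_mul (by positivity), ← ENNReal.ofReal_mul (by positivity)]
  congr 1
  have hexp : -((t / s) ^ p) = -(t ^ p * s ^ (-p)) := by
    rw [Real.div_rpow ht.le hs0.le, Real.rpow_neg hs0.le, div_eq_mul_inv]
  have hts : (t / s) ^ (-α - 1) = t ^ (-α - 1) * s ^ (α + 1) := by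
    rw [Real.div_rpow ht.le hs0.le, div_eq_mul_inv, ← Real.rpow_neg hs0.le]
    congr 2
    ring
  have hs1 : s ^ (-α - p - 1) * s⁻¹ * s ^ (α + 1) = s ^ (-p - 1) := by
    rw [← Real.rpow_neg_one, ← Real.rpow_add hs0, ← Real.rpow_add hs0]
    congr 1
    ring
  rw [hexp, hts, ← hs1]
  ring

theorem lintegral_piMeasure_psi {α p q : ℝ} (hq : 0 < q) (hqp : q < p) {g : ℝ → ENNReal}
    (hg : Measurable g) :
    ∫⁻ s, ∫⁻ u, g (s * u) ∂(psi α p) ∂(piMeasure α p q) = ∫⁻ t, g t ∂(psi α q) := by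
  have hp : 0 < p := hq.trans hqp
  have hfm : Measurable (stableDensity (q / p)) :=
    (isStableDensity_stableDensity (div_pos hq hp) ((div_lt_one hp).2 hqp)).1
  exact lintegral_lintegral_mul_withDensity measurableSet_Ioi subset_rfl (by fun_prop)
    (by fun_prop) (by fun_prop) (fun _ ht => lintegral_piMeasure_density hq hqp ht) hg


/-! ### The domain of `Ψ_{α,p}`. -/

theorem upsilon_singleton_zero {d : ℕ} {ρ : Measure ℝ} (hρ : ∀ᵐ s ∂ρ, 0 < s)
    {M : Measure (EuclideanSpace ℝ (Fin d))} [SFinite M] (hM : M {0} = 0) :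
    upsilon ρ M {0} = 0 := by
  rw [upsilon_apply ρ M (measurableSet_singleton 0)]
  refine lintegral_eq_zero_of_ae_eq_zero ?_
  filter_upwards [hρ] with s hs
  have h0 : (fun x : EuclideanSpace ℝ (Fin d) => s • x) ⁻¹' {0} = {0} := by
    ext x
    simp [hs.ne']
  rw [h0, hM]
  rfl

theorem ae_pos_psi (α p : ℝ) : ∀ᵐ s ∂(psi α p), 0 < s :=
  withDensity_absolutelyContinuous _ _ (ae_restrict_mem measurableSet_Ioi)

theorem min_norm_smul_sq_le {E : Type*} [NormedAddCommGroup E] [NormedSpace ℝ E] (s : ℝ) (x : E) :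
    min (‖s • x‖ ^ 2) 1 ≤ max (s ^ 2) 1 * min (‖x‖ ^ 2) 1 := by
  rw [norm_smul, mul_pow, Real.norm_eq_abs, sq_abs]
  have h1 := le_max_left (s ^ 2) 1
  have h2 := le_max_right (s ^ 2) 1
  rcases le_total (‖x‖ ^ 2) 1 with h | h
  · rw [min_eq_left h]
    exact (min_le_left _ _).trans (mul_le_mul_of_nonneg_right h1 (sq_nonneg _))
  · rw [min_eq_right h, mul_one]
    exact (min_le_right _ _).trans h2

theorem lintegral_rpow_mul_exp_Ioi_one_lt_top (a : ℝ) {p : ℝ} (hp : 0 < p) :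
    ∫⁻ s in Ioi (1 : ℝ), ENNReal.ofReal (s ^ a * Real.exp (-(s ^ p))) < ⊤ := by
  -- Raising the exponent to `max a 0` only enlarges the integrand for `s > 1`, and secures
  -- integrability at `0`.
  have h : IntegrableOn (fun s : ℝ => s ^ (max a 0) * Real.exp (-(s ^ p))) (Ioi 1) :=
    (integrableOn_rpow_mul_exp_neg_rpow (by linarith [le_max_right a 0]) hp).mono_set
      (Ioi_subset_Ioi zero_le_one)
  refine lt_of_le_of_lt ?_ h.lintegral_lt_top
  refine setLIntegral_mono' measurableSet_Ioi fun s hs => ENNReal.ofReal_le_ofReal ?_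
  exact mul_le_mul_of_nonneg_right
    (Real.rpow_le_rpow_of_exponent_le (le_of_lt hs) (le_max_left a 0)) (Real.exp_pos _).le

/-- The domain of `Ψ_{α,p}` decreases with `α` and does not depend on `p`. -/
theorem upsilonDomain_psi_mono {d : ℕ} {α α' p p' : ℝ} (hα : α' ≤ α) (hp : 0 < p) (hp' : 0 < p') :
    upsilonDomain d (psi α p) ⊆ upsilonDomain d (psi α' p') := by
  rintro M ⟨hM, hΨ⟩
  have := hM.sigmaFinite
  refine ⟨hM, upsilon_singleton_zero (ae_pos_psi _ _) hM.1, ?_⟩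
  set H : ℝ → ENNReal := fun s => ∫⁻ x, ENNReal.ofReal (min (‖s • x‖ ^ 2) 1) ∂M with hH
  have hHm : Measurable H := Measurable.lintegral_prod_right'
    (f := fun z : ℝ × EuclideanSpace ℝ (Fin d) => ENNReal.ofReal (min (‖z.1 • z.2‖ ^ 2) 1))
    (by fun_prop)
  have h1 := hΨ.2
  rw [lintegral_upsilon _ _ (by fun_prop), psi,
    lintegral_restrict_withDensity (by fun_prop) hHm] at h1
  rw [lintegral_upsilon _ _ (by fun_prop), psi, lintegral_restrict_withDensity (by fun_prop) hHm,
    ← Ioc_union_Ioi_eq_Ioi zero_le_one, lintegral_union measurableSet_Ioi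
      (Ioc_disjoint_Ioi le_rfl), ENNReal.add_lt_top]
  constructor
  -- For `s ≤ 1` the powers compare because `α' ≤ α`, while `exp(-s^p) ≥ exp(-1)` makes the
  -- exponential factors harmless.
  · have hle : ∫⁻ s in Ioc (0 : ℝ) 1, ENNReal.ofReal (s ^ (-α' - 1) * Real.exp (-(s ^ p'))) * H s
        ≤ ∫⁻ s in Ioc (0 : ℝ) 1, ENNReal.ofReal (Real.exp 1) *
          (ENNReal.ofReal (s ^ (-α - 1) * Real.exp (-(s ^ p))) * H s) := by
      refine setLIntegral_mono' measurableSet_Ioc fun s hs => ?_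
      have hs0 : 0 < s := hs.1
      rw [← mul_assoc, ← ENNReal.ofReal_mul (Real.exp_pos 1).le]
      refine mul_le_mul' (ENNReal.ofReal_le_ofReal ?_) le_rfl
      have e1 : s ^ (-α' - 1) ≤ s ^ (-α - 1) :=
        Real.rpow_le_rpow_of_exponent_ge hs0 hs.2 (by linarith)
      have e2 : Real.exp (-(s ^ p')) ≤ 1 :=
        Real.exp_le_one_iff.2 (neg_nonpos.2 (Real.rpow_nonneg hs0.le _))
      have e3 : 1 ≤ Real.exp 1 * Real.exp (-(s ^ p)) := by
        rw [← Real.exp_add]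
        refine Real.one_le_exp ?_
        linarith [Real.rpow_le_one hs0.le hs.2 hp.le]
      have e4 : 0 < s ^ (-α' - 1) := Real.rpow_pos_of_pos hs0 _
      calc s ^ (-α' - 1) * Real.exp (-(s ^ p')) ≤ s ^ (-α - 1) * 1 :=
            mul_le_mul e1 e2 (Real.exp_pos _).le (e4.le.trans e1)
        _ ≤ s ^ (-α - 1) * (Real.exp 1 * Real.exp (-(s ^ p))) :=
            mul_le_mul_of_nonneg_left e3 (e4.le.trans e1)
        _ = _ := by ring
    refine hle.trans_lt ?_
    rw [lintegral_const_mul _ (by fun_prop)]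
    refine ENNReal.mul_lt_top ENNReal.ofReal_lt_top (lt_of_le_of_lt ?_ h1)
    exact lintegral_mono_set Ioc_subset_Ioi_self
  -- For `s > 1` only the Lévy property of `M` is needed: `H s` grows at most like `s²`, and the
  -- exponential beats every power.
  · have hle : ∫⁻ s in Ioi (1 : ℝ), ENNReal.ofReal (s ^ (-α' - 1) * Real.exp (-(s ^ p'))) * H s
        ≤ ∫⁻ s in Ioi (1 : ℝ), ENNReal.ofReal (s ^ (-α' + 1) * Real.exp (-(s ^ p'))) *
          ∫⁻ x, ENNReal.ofReal (min (‖x‖ ^ 2) 1) ∂M := by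
      refine setLIntegral_mono' measurableSet_Ioi fun s hs => ?_
      have hs1 : (1 : ℝ) < s := hs
      have hs0 : 0 < s := by linarith
      have e1 : H s ≤ ENNReal.ofReal (s ^ 2) * ∫⁻ x, ENNReal.ofReal (min (‖x‖ ^ 2) 1) ∂M := by
        rw [← lintegral_const_mul _ (by fun_prop)]
        refine lintegral_mono fun x => ?_
        rw [← ENNReal.ofReal_mul (sq_nonneg s)]
        refine ENNReal.ofReal_le_ofReal ((min_norm_smul_sq_le s x).trans ?_)
        rw [max_eq_left (by nlinarith)]
      refine (mul_le_mul_right e1 _).trans ?_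
      rw [← mul_assoc, ← ENNReal.ofReal_mul (by positivity)]
      refine le_of_eq ?_
      congr 2
      rw [show -α' + 1 = -α' - 1 + (2 : ℕ) by push_cast; ring, Real.rpow_add_natCast hs0.ne']
      ring
    refine hle.trans_lt ?_
    rw [lintegral_mul_const _ (by fun_prop)]
    exact ENNReal.mul_lt_top (lintegral_rpow_mul_exp_Ioi_one_lt_top _ hp') hM.2


/-! ### Injectivity of `Ψ_{α,p}`. -/

/-- A finite measure is determined by the moments of an injective bounded continuous function. -/
theorem measure_ext_of_integral_pow {E : Type*} [TopologicalSpace E] [PolishSpace E]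
    [MeasurableSpace E] [BorelSpace E] {P P' : Measure E} [IsFiniteMeasure P] [IsFiniteMeasure P']
    (g : BoundedContinuousFunction E ℝ) (hg : Function.Injective g)
    (h : ∀ n : ℕ, ∫ x, g x ^ n ∂P = ∫ x, g x ^ n ∂P') : P = P' := by
  let A : StarSubalgebra ℝ (BoundedContinuousFunction E ℝ) :=
    { Algebra.adjoin ℝ {g} with
      star_mem' := fun {a} ha => by
        have : star a = a := by
          ext x
          simp
        rwa [this] }
  -- The polynomials in `g` separate points because `g` is injective, and their integrals are
  -- combinations of the moments.
  refine ext_of_forall_mem_subalgebra_integral_eq_of_polish (𝕜 := ℝ) (A := A) ?_ ?_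
  · intro x y hxy
    refine ⟨g, ⟨g.toContinuousMap, ⟨g, ?_, rfl⟩, rfl⟩, fun hgxy => hxy (hg hgxy)⟩
    exact Algebra.subset_adjoin (mem_singleton g)
  · intro f hf
    have hf' : f ∈ Algebra.adjoin ℝ {g} := hf
    rw [Algebra.adjoin_singleton_eq_range_aeval] at hf'
    obtain ⟨q, rfl⟩ := hf'
    have hq : ∀ x, (Polynomial.aeval g q : BoundedContinuousFunction E ℝ) x
        = ∑ k ∈ Finset.range (q.natDegree + 1), q.coeff k * g x ^ k := by
      intro x
      rw [Polynomial.aeval_eq_sum_range]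
      simp
    have hi : ∀ (m : Measure E) [IsFiniteMeasure m] (k : ℕ), Integrable (fun x => g x ^ k) m := by
      intro m _ k
      exact (g ^ k).integrable m
    change ∫ x, (Polynomial.aeval g q : BoundedContinuousFunction E ℝ) x ∂P
      = ∫ x, (Polynomial.aeval g q : BoundedContinuousFunction E ℝ) x ∂P'
    simp_rw [hq]
    rw [integral_finsetSum _ fun k _ => (hi P k).const_mul _,
      integral_finsetSum _ fun k _ => (hi P' k).const_mul _]
    simp_rw [integral_const_mul, h]

/-- Uniqueness of the Laplace transform, in the variable `u ^ p`. -/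
theorem measure_ext_of_lintegral_exp_rpow {p : ℝ} (hp : 0 < p) {m m' : Measure ℝ}
    [IsFiniteMeasure m] [IsFiniteMeasure m'] (hm : ∀ᵐ u ∂m, u ∈ Ioi (0 : ℝ))
    (hm' : ∀ᵐ u ∂m', u ∈ Ioi (0 : ℝ))
    (h : ∀ n : ℕ, ∫⁻ u, ENNReal.ofReal (Real.exp (-(n * u ^ p))) ∂m
      = ∫⁻ u, ENNReal.ofReal (Real.exp (-(n * u ^ p))) ∂m') : m = m' := by
  -- The function `exp(-u^p)` need not be injective on the whole line, so the measures are pulled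
  -- back to `(0, ∞)`. Its `n`-th powers are the given exponentials.
  have : PolishSpace (Ioi (0 : ℝ)) := isOpen_Ioi.polishSpace
  let g : BoundedContinuousFunction (Ioi (0 : ℝ)) ℝ :=
    BoundedContinuousFunction.ofNormedAddCommGroup (fun u => Real.exp (-((u : ℝ) ^ p)))
      (by
        refine Real.continuous_exp.comp (Continuous.neg ?_)
        exact continuous_subtype_val.rpow_const fun u => Or.inr hp.le) 1 (fun u => by
        rw [Real.norm_eq_abs, abs_of_pos (Real.exp_pos _)]
        exact Real.exp_le_one_iff.2 (neg_nonpos.2 (Real.rpow_nonneg (le_of_lt u.2) _)))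
  have hg : Function.Injective g := by
    intro u v huv
    have h1 : -((u : ℝ) ^ p) = -((v : ℝ) ^ p) := Real.exp_injective huv
    exact Subtype.ext ((Real.rpow_left_inj (le_of_lt u.2) (le_of_lt v.2) hp.ne').1 (neg_inj.1 h1))
  have hfin : ∀ (μ : Measure ℝ) [IsFiniteMeasure μ],
      IsFiniteMeasure (μ.comap ((↑) : Ioi (0 : ℝ) → ℝ)) := fun μ _ =>
    ⟨by
      rw [(MeasurableEmbedding.subtype_coe measurableSet_Ioi).comap_apply]
      exact measure_lt_top _ _⟩
  have := hfin m
  have := hfin m'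
  have hmom : ∀ (μ : Measure ℝ), (∀ᵐ u ∂μ, u ∈ Ioi (0 : ℝ)) → ∀ n : ℕ,
      ∫ u, g u ^ n ∂(μ.comap ((↑) : Ioi (0 : ℝ) → ℝ))
        = (∫⁻ u, ENNReal.ofReal (Real.exp (-(n * u ^ p))) ∂μ).toReal := by
    intro μ hμ n
    have h1 : ∀ u : Ioi (0 : ℝ), g u ^ n = (fun u : ℝ => Real.exp (-(n * u ^ p))) u := by
      intro u
      change Real.exp (-((u : ℝ) ^ p)) ^ n = _
      rw [← Real.exp_nat_mul]
      ring_nf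
    simp_rw [h1]
    rw [integral_subtype_comap measurableSet_Ioi (fun u : ℝ => Real.exp (-(n * u ^ p))),
      Measure.restrict_eq_self_of_ae_mem hμ, integral_eq_lintegral_of_nonneg_ae
        (ae_of_all _ fun u => (Real.exp_pos _).le) (by fun_prop)]
  have key : m.comap ((↑) : Ioi (0 : ℝ) → ℝ) = m'.comap ((↑) : Ioi (0 : ℝ) → ℝ) :=
    measure_ext_of_integral_pow g hg fun n => by rw [hmom m hm, hmom m' hm', h]
  have := congrArg (Measure.map ((↑) : Ioi (0 : ℝ) → ℝ)) key
  rwa [map_comap_subtype_coe measurableSet_Ioi, map_comap_subtype_coe measurableSet_Ioi,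
    Measure.restrict_eq_self_of_ae_mem hm, Measure.restrict_eq_self_of_ae_mem hm'] at this

/-- The integral of the dilation of a bounded function weighted by `|x|^2 ∧ 1`. -/
noncomputable def dilatedIntegral {d : ℕ}
    (g : BoundedContinuousFunction (EuclideanSpace ℝ (Fin d)) NNReal)
    (M : Measure (EuclideanSpace ℝ (Fin d))) (s : ℝ) : ENNReal :=
  ∫⁻ x, ENNReal.ofReal (min (‖s • x‖ ^ 2) 1) * g (s • x) ∂M

theorem measurable_dilatedIntegral {d : ℕ}
    (g : BoundedContinuousFunction (EuclideanSpace ℝ (Fin d)) NNReal)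
    (M : Measure (EuclideanSpace ℝ (Fin d))) [SFinite M] : Measurable (dilatedIntegral g M) := by
  have hg : Measurable g := g.continuous.measurable
  exact Measurable.lintegral_prod_right' (f := fun z : ℝ × EuclideanSpace ℝ (Fin d) =>
    ENNReal.ofReal (min (‖z.1 • z.2‖ ^ 2) 1) * g (z.1 • z.2)) (by fun_prop)

theorem exists_coe_le {X : Type*} [TopologicalSpace X]
    (g : BoundedContinuousFunction X NNReal) : ∃ C : NNReal, ∀ x, g x ≤ C :=
  ⟨nndist g 0, fun x => BoundedContinuousFunction.NNReal.upper_bound g x⟩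

/-- Dominated convergence, with dilations bounded by `|s₀| + 1` near `s₀`. Continuity serves to turn
equality for almost every dilation into equality at `s = 1`. -/
theorem continuous_dilatedIntegral {d : ℕ}
    (g : BoundedContinuousFunction (EuclideanSpace ℝ (Fin d)) NNReal)
    {M : Measure (EuclideanSpace ℝ (Fin d))} (hM : IsLevyMeasure M) :
    Continuous (dilatedIntegral g M) := by
  have hg : Measurable g := g.continuous.measurable
  obtain ⟨C, hC⟩ := exists_coe_le g
  refine continuous_iff_continuousAt.2 fun s₀ => ?_
  refine tendsto_lintegral_filter_of_dominated_convergence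
    (fun x => ENNReal.ofReal (max ((|s₀| + 1) ^ 2) 1) * ENNReal.ofReal (min (‖x‖ ^ 2) 1) * C)
    (Eventually.of_forall fun s => by fun_prop) ?_ ?_ ?_
  · filter_upwards [Metric.ball_mem_nhds s₀ one_pos] with s hs
    refine ae_of_all _ fun x => ?_
    rw [← ENNReal.ofReal_mul (by positivity)]
    refine mul_le_mul' (ENNReal.ofReal_le_ofReal ((min_norm_smul_sq_le s x).trans ?_))
      (ENNReal.coe_le_coe.2 (hC _))
    have hs1 : |s| ≤ |s₀| + 1 := by
      rw [Metric.mem_ball, Real.dist_eq] at hs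
      have := abs_sub_abs_le_abs_sub s s₀
      linarith
    have : s ^ 2 ≤ (|s₀| + 1) ^ 2 := by
      rw [← sq_abs]
      exact pow_le_pow_left₀ (abs_nonneg s) hs1 2
    gcongr
  · rw [lintegral_mul_const _ (by fun_prop), lintegral_const_mul _ (by fun_prop)]
    exact ENNReal.mul_ne_top (ENNReal.mul_ne_top ENNReal.ofReal_ne_top hM.2.ne)
      ENNReal.coe_ne_top
  · refine ae_of_all _ fun x => ?_
    have h1 : Continuous fun s : ℝ => ENNReal.ofReal (min (‖s • x‖ ^ 2) 1) :=
      ENNReal.continuous_ofReal.comp (by fun_prop)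
    have h2 : Continuous fun s : ℝ => (g (s • x) : ENNReal) := by fun_prop
    exact ENNReal.Tendsto.mul (h1.tendsto s₀) (Or.inr ENNReal.coe_ne_top) (h2.tendsto s₀)
      (Or.inr ENNReal.ofReal_ne_top)

/-- Rescaling by `r` turns the exponent `u^p` into `r^p u^p`. So the Laplace transform in `u^p` of
the weighted dilated integrals depends on `M` only through `Ψ_{α,p} M`. -/
theorem lintegral_scaled_eq {d : ℕ} {α p : ℝ}
    (g : BoundedContinuousFunction (EuclideanSpace ℝ (Fin d)) NNReal)
    {M : Measure (EuclideanSpace ℝ (Fin d))} [SFinite M] {r : ℝ} (hr : 0 < r) :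
    ∫⁻ u in Ioi (0 : ℝ),
        ENNReal.ofReal (u ^ (-α - 1) * Real.exp (-(r ^ p * u ^ p))) * dilatedIntegral g M u
      = ENNReal.ofReal (r ^ α) *
        ∫⁻ y, ENNReal.ofReal (min (‖r⁻¹ • y‖ ^ 2) 1) * g (r⁻¹ • y) ∂(upsilon (psi α p) M) := by
  have hg : Measurable g := g.continuous.measurable
  have hH := measurable_dilatedIntegral g M
  have h1 : ∀ s : ℝ, ∫⁻ x, ENNReal.ofReal (min (‖r⁻¹ • s • x‖ ^ 2) 1) * g (r⁻¹ • s • x) ∂M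
      = dilatedIntegral g M (s / r) := by
    intro s
    simp_rw [smul_smul, inv_mul_eq_div]
    rfl
  rw [lintegral_upsilon _ _ (by fun_prop)]
  simp_rw [h1]
  rw [psi, lintegral_restrict_withDensity (by fun_prop) (by fun_prop),
    setLIntegral_Ioi_comp_div _ hr, ← lintegral_const_mul _ (by fun_prop)]
  refine setLIntegral_congr_fun measurableSet_Ioi fun t ht => ?_
  have ht0 : 0 < t := ht
  rw [← mul_assoc, ← mul_assoc, ← ENNReal.ofReal_mul (by positivity),
    ← ENNReal.ofReal_mul (by positivity)]
  congr 2
  have e1 : r ^ p * (t / r) ^ p = t ^ p := by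
    rw [← Real.mul_rpow hr.le (by positivity), mul_div_cancel₀ t hr.ne']
  have e2 : (t / r) ^ (-α - 1) = t ^ (-α - 1) * (r ^ α * r) := by
    rw [Real.div_rpow ht0.le hr.le, div_eq_mul_inv, ← Real.rpow_neg hr.le, ← Real.rpow_add_one hr.ne']
    congr 2
    ring
  rw [e1, e2]
  field_simp

/-- The transform `Ψ_{α,p}` is one-to-one. -/
theorem injOn_upsilon_psi {d : ℕ} {α p : ℝ} (hp : 0 < p) :
    InjOn (upsilon (psi α p)) (upsilonDomain d (psi α p)) := by
  rintro M₁ ⟨hM₁, hΨ₁⟩ M₂ ⟨hM₂, hΨ₂⟩ heq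
  have := hM₁.sigmaFinite
  have := hM₂.sigmaFinite
  -- The weight makes a Lévy measure finite and vanishes only at the null set `{0}`, so it can be
  -- divided out again.
  set w : EuclideanSpace ℝ (Fin d) → ENNReal := fun x => ENNReal.ofReal (min (‖x‖ ^ 2) 1) with hw_def
  have hw : Measurable w := by fun_prop
  have hrec : ∀ M : Measure (EuclideanSpace ℝ (Fin d)), IsLevyMeasure M →
      (M.withDensity w).withDensity w⁻¹ = M := by
    intro M hM
    refine withDensity_inv_same hw ?_ (ae_of_all _ fun x => ENNReal.ofReal_ne_top)
    have h0 : ∀ᵐ x ∂M, x ≠ 0 := by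
      simpa [ae_iff] using hM.1
    filter_upwards [h0] with x hx
    rw [hw_def]
    simp only [ne_eq, ENNReal.ofReal_eq_zero, not_le]
    positivity
  rw [← hrec M₁ hM₁, ← hrec M₂ hM₂]
  congr 1
  have hfin₁ : IsFiniteMeasure (M₁.withDensity w) := isFiniteMeasure_withDensity hM₁.2.ne
  refine ext_of_forall_lintegral_eq_of_IsFiniteMeasure fun g => ?_
  have hg : Measurable g := g.continuous.measurable
  obtain ⟨C, hC⟩ := exists_coe_le g
  have hone : ∀ M : Measure (EuclideanSpace ℝ (Fin d)),
      ∫⁻ x, g x ∂(M.withDensity w) = dilatedIntegral g M 1 := by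
    intro M
    rw [lintegral_withDensity_eq_lintegral_mul _ hw (by fun_prop), dilatedIntegral]
    simp [hw_def]
  rw [hone, hone]
  let b : Measure (EuclideanSpace ℝ (Fin d)) → ℝ → ENNReal := fun M u =>
    ENNReal.ofReal (u ^ (-α - 1) * Real.exp (-(u ^ p))) * dilatedIntegral g M u
  have hbm : ∀ (M : Measure (EuclideanSpace ℝ (Fin d))) [SFinite M], Measurable (b M) := by
    intro M _
    have := measurable_dilatedIntegral g M
    fun_prop
  have hbfin : ∀ M : Measure (EuclideanSpace ℝ (Fin d)), IsLevyMeasure M →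
      IsLevyMeasure (upsilon (psi α p) M) → ∫⁻ u in Ioi (0 : ℝ), b M u ≠ ⊤ := by
    intro M hM hΨ
    have := hM.sigmaFinite
    have h1 := lintegral_scaled_eq (α := α) (p := p) g (M := M) one_pos
    simp only [Real.one_rpow, one_mul, inv_one, one_smul, ENNReal.ofReal_one] at h1
    change ∫⁻ u in Ioi (0 : ℝ), ENNReal.ofReal (u ^ (-α - 1) * Real.exp (-(u ^ p))) *
      dilatedIntegral g M u ≠ ⊤
    rw [h1]
    refine ne_top_of_le_ne_top (b := (∫⁻ y, w y ∂(upsilon (psi α p) M)) * C)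
      (ENNReal.mul_ne_top hΨ.2.ne ENNReal.coe_ne_top) ?_
    rw [← lintegral_mul_const _ hw]
    exact lintegral_mono fun y => mul_le_mul' le_rfl (ENNReal.coe_le_coe.2 (hC y))
  let m : Measure (EuclideanSpace ℝ (Fin d)) → Measure ℝ := fun M =>
    (volume.restrict (Ioi (0 : ℝ))).withDensity (b M)
  have hmfin₁ : IsFiniteMeasure (m M₁) := isFiniteMeasure_withDensity (hbfin M₁ hM₁ hΨ₁)
  have hmfin₂ : IsFiniteMeasure (m M₂) := isFiniteMeasure_withDensity (hbfin M₂ hM₂ hΨ₂)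
  have hmpos : ∀ M, ∀ᵐ u ∂(m M), u ∈ Ioi (0 : ℝ) := fun M =>
    withDensity_absolutelyContinuous _ _ (ae_restrict_mem measurableSet_Ioi)
  -- Take `r = (n+1)^(1/p)`: one unit of `r^p = n + 1` is already in the density `b`, which keeps `m
  -- M` finite, and `n` remains as Laplace variable.
  have hlap : ∀ (M : Measure (EuclideanSpace ℝ (Fin d))) [SFinite M] (n : ℕ),
      ∫⁻ u, ENNReal.ofReal (Real.exp (-(n * u ^ p))) ∂(m M)
        = ENNReal.ofReal ((((n : ℝ) + 1) ^ p⁻¹) ^ α) * ∫⁻ y, ENNReal.ofReal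
          (min (‖(((n : ℝ) + 1) ^ p⁻¹)⁻¹ • y‖ ^ 2) 1) * g ((((n : ℝ) + 1) ^ p⁻¹)⁻¹ • y)
          ∂(upsilon (psi α p) M) := by
    intro M _ n
    have hn : (0 : ℝ) < (n : ℝ) + 1 := by positivity
    rw [← lintegral_scaled_eq g (Real.rpow_pos_of_pos hn _),
      lintegral_restrict_withDensity (hbm M) (by fun_prop), Real.rpow_inv_rpow hn.le hp.ne']
    refine setLIntegral_congr_fun measurableSet_Ioi fun u hu => ?_
    have hu0 : 0 < u := hu
    change ENNReal.ofReal (u ^ (-α - 1) * Real.exp (-(u ^ p))) * dilatedIntegral g M u *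
      ENNReal.ofReal (Real.exp (-(n * u ^ p))) = _
    rw [mul_right_comm, ← ENNReal.ofReal_mul (by positivity), mul_assoc, ← Real.exp_add]
    ring_nf
  have hm : m M₁ = m M₂ := measure_ext_of_lintegral_exp_rpow hp (hmpos M₁) (hmpos M₂) fun n => by
    rw [hlap, hlap, heq]
  have hae : b M₁ =ᵐ[volume.restrict (Ioi (0 : ℝ))] b M₂ :=
    (withDensity_eq_iff (hbm M₁).aemeasurable (hbm M₂).aemeasurable (hbfin M₁ hM₁ hΨ₁)).1 hm
  have hae' : dilatedIntegral g M₁ =ᵐ[volume.restrict (Ioi (0 : ℝ))] dilatedIntegral g M₂ := by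
    filter_upwards [hae, ae_restrict_mem measurableSet_Ioi] with u hu hu0
    have hu0' : (0 : ℝ) < u := hu0
    refine (ENNReal.mul_right_inj ?_ ENNReal.ofReal_ne_top).1 hu
    simp only [ne_eq, ENNReal.ofReal_eq_zero, not_le]
    positivity
  exact Measure.eqOn_open_of_ae_eq hae' isOpen_Ioi
    (continuous_dilatedIntegral g hM₁).continuousOn
    (continuous_dilatedIntegral g hM₂).continuousOn (mem_Ioi.2 one_pos)


/-! ### The two bijections. -/

theorem upsilon_tau_upsilon_psi {d : ℕ} {β α p : ℝ} (hβ : β < α) (hp : 0 < p)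
    {M : Measure (EuclideanSpace ℝ (Fin d))} (hM : IsLevyMeasure M) :
    upsilon (tau β α p) (upsilon (psi β p) M) = upsilon (psi α p) M := by
  have := hM.sigmaFinite
  exact upsilon_upsilon M fun g hg => lintegral_tau_psi hβ hp hg

theorem upsilon_piMeasure_upsilon_psi {d : ℕ} {α p q : ℝ} (hq : 0 < q) (hqp : q < p)
    {M : Measure (EuclideanSpace ℝ (Fin d))} (hM : IsLevyMeasure M) :
    upsilon (piMeasure α p q) (upsilon (psi α p) M) = upsilon (psi α q) M := by
  have := hM.sigmaFinite
  exact upsilon_upsilon M fun g hg => lintegral_piMeasure_psi hq hqp hg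

theorem bijOn_upsilon_tau (d : ℕ) {β α p : ℝ} (hβ : β < α) (hp : 0 < p) :
    BijOn (upsilon (tau β α p)) (LTS d β p ∩ upsilonDomain d (tau β α p)) (LTS d α p) := by
  rw [LTS_eq_upsilonRange, LTS_eq_upsilonRange]
  refine ⟨?_, ?_, ?_⟩
  · rintro _ ⟨⟨M, hM, rfl⟩, hD⟩
    -- Membership in the domain of the transform says precisely that `Ψ_{α,p} M` is a Lévy measure.
    have h := hD.2
    have hc := upsilon_tau_upsilon_psi hβ hp hM.1
    rw [hc] at h
    exact ⟨M, ⟨hM.1, h⟩, hc⟩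
  · rintro _ ⟨⟨M₁, hM₁, rfl⟩, hD₁⟩ _ ⟨⟨M₂, hM₂, rfl⟩, hD₂⟩ heq
    have h₁ := hD₁.2
    have h₂ := hD₂.2
    rw [upsilon_tau_upsilon_psi hβ hp hM₁.1] at h₁ heq
    rw [upsilon_tau_upsilon_psi hβ hp hM₂.1] at h₂ heq
    rw [injOn_upsilon_psi hp ⟨hM₁.1, h₁⟩ ⟨hM₂.1, h₂⟩ heq]
  · rintro _ ⟨M, hM, rfl⟩
    have hM' := upsilonDomain_psi_mono hβ.le hp hp hM
    have hc := upsilon_tau_upsilon_psi hβ hp hM.1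
    refine ⟨upsilon (psi β p) M, ⟨⟨M, hM', rfl⟩, hM'.2, ?_⟩, hc⟩
    rw [hc]
    exact hM.2

theorem LTS_subset_upsilonDomain_piMeasure (d : ℕ) {α p q : ℝ} (hq : 0 < q) (hqp : q < p) :
    LTS d α p ⊆ upsilonDomain d (piMeasure α p q) := by
  rw [LTS_eq_upsilonRange]
  rintro _ ⟨M, hM, rfl⟩
  refine ⟨hM.2, ?_⟩
  rw [upsilon_piMeasure_upsilon_psi hq hqp hM.1]
  exact (upsilonDomain_psi_mono le_rfl (hq.trans hqp) hq hM).2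

theorem bijOn_upsilon_piMeasure (d : ℕ) {α p q : ℝ} (hq : 0 < q) (hqp : q < p) :
    BijOn (upsilon (piMeasure α p q)) (LTS d α p) (LTS d α q) := by
  have hp : 0 < p := hq.trans hqp
  rw [LTS_eq_upsilonRange, LTS_eq_upsilonRange]
  refine ⟨?_, ?_, ?_⟩
  · rintro _ ⟨M, hM, rfl⟩
    exact ⟨M, upsilonDomain_psi_mono le_rfl hp hq hM,
      upsilon_piMeasure_upsilon_psi hq hqp hM.1⟩
  · rintro _ ⟨M₁, hM₁, rfl⟩ _ ⟨M₂, hM₂, rfl⟩ heq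
    rw [upsilon_piMeasure_upsilon_psi hq hqp hM₁.1,
      upsilon_piMeasure_upsilon_psi hq hqp hM₂.1] at heq
    -- Injectivity is that of `Ψ_{α,q}`, whose domain contains that of `Ψ_{α,p}`.
    rw [injOn_upsilon_psi hq (upsilonDomain_psi_mono le_rfl hp hq hM₁)
      (upsilonDomain_psi_mono le_rfl hp hq hM₂) heq]
  · rintro _ ⟨M, hM, rfl⟩
    exact ⟨upsilon (psi α p) M, ⟨M, upsilonDomain_psi_mono le_rfl hq hp hM, rfl⟩,
      upsilon_piMeasure_upsilon_psi hq hqp hM.1⟩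

end TemperedStable

theorem corollary6 (d : ℕ) :
    (∀ β α p : ℝ, β < α → α < 2 → 0 < p →
      Set.BijOn (TemperedStable.upsilon (TemperedStable.tau β α p))
        (TemperedStable.LTS d β p ∩
          TemperedStable.upsilonDomain d (TemperedStable.tau β α p))
        (TemperedStable.LTS d α p)) ∧
    (∀ α p q : ℝ, α < 2 → 0 < q → q < p →
      TemperedStable.LTS d α p ⊆
          TemperedStable.upsilonDomain d (TemperedStable.piMeasure α p q) ∧
        Set.BijOn (TemperedStable.upsilon (TemperedStable.piMeasure α p q))
          (TemperedStable.LTS d α p) (TemperedStable.LTS d α q)) := by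
  exact ⟨fun β α p hβ _ hp => TemperedStable.bijOn_upsilon_tau d hβ hp,
    fun α p q _ hq hqp => ⟨TemperedStable.LTS_subset_upsilonDomain_piMeasure d hq hqp,
      TemperedStable.bijOn_upsilon_piMeasure d hq hqp⟩⟩
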